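/- Let $(M^{2n},\bar\omega)$ be a compact symplectic manifold (smooth, Hausdorff, without boundary), and let $J$ be a smooth almost complex structure on $M$ compatible with $\bar\omega$, i.e. $\bar\omega(X,JX)>0$ for all $0\neq X\in TM$ and $\bar\omega(JX,JY)=\bar\omega(X,Y)$. For a smooth function $\rho:M\to\mathbb R$ put $d^c\rho=\sqrt{-1}(\bar\partial\rho-\partial\rho)=-d\rho\circ J$ and $\bar\omega_\rho=\bar\omega+dd^c\rho$, and let $$\mathcal H=\{\rho\in C^\infty(M,\mathbb R)\;:\;\bar\omega_\rho(X,JX)>0\text{ for all }0\ne X\in TM\}.$$ For $\rho\in\mathcal H$ let $\bar g_\rho$ be the Riemannian metric $\bar g_\rho(X,Y)=\tfrac12\big(\bar\omega_\rho(X,JY)+\bar\omega_\rho(Y,JX)\big)$. Let $\Sigma$ be a closed surface (compact, Hausdorff, without boundary, not necessarily orientable or connected), let $F:\Sigma\to M$ be a smooth immersion, and let $\mathcal A(\rho)=\mathrm{Area}(\Sigma,F^*\bar g_\rho)$ for $\rho\in\mathcal H$. A point $\rho\in\mathcal H$ is called a critical point of $\mathcal A$ if for every $\varepsilon>0$ and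 every smooth path $\varphi:(-\varepsilon,\varepsilon)\to\mathcal H$ (i.e. $(t,x)\mapsto\varphi(t)(x)$ is smooth on $(-\varepsilon,\varepsilon)\times M$) with $\varphi(0)=\rho$ one has $\frac{d}{dt}\big|_{t=0}\mathcal A(\varphi(t))=0$. Theorem. If $\mathcal A$ has a critical point $\rho\in\mathcal H$, then $F$ is $J$-holomorphic, that is, $J_{F(x)}$ maps $F_{*x}(T_x\Sigma)$ onto itself for every $x\in\Sigma$. -/

import Mathlib

open scoped Manifold ContDiff Topology

noncomputable section

namespace JCurve

/-! ### Differential forms on a manifold modelled on a normed space -/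

section Forms

variable {E : Type*} [NormedAddCommGroup E] [NormedSpace ℝ E]
  {M : Type*} [TopologicalSpace M] [ChartedSpace E M]

variable (E M) in
/-- A (not necessarily smooth) real differential `k`-form on `M`. -/
abbrev Form (k : ℕ) : Type _ := ∀ x : M, (TangentSpace 𝓘(ℝ, E) x) [⋀^Fin k]→L[ℝ] ℝ

/-- The differential at `y` of the inverse of the preferred chart at `p`. -/
def chartInvDeriv (p : M) (y : E) :
    E →L[ℝ] TangentSpace 𝓘(ℝ, E) ((extChartAt 𝓘(ℝ, E) p).symm y) :=
  mfderiv 𝓘(ℝ, E) 𝓘(ℝ, E) (extChartAt 𝓘(ℝ, E) p).symm y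

/-- The differential at `x` of the preferred chart at `x`. -/
def chartDeriv (x : M) : TangentSpace 𝓘(ℝ, E) x →L[ℝ] E :=
  mfderiv 𝓘(ℝ, E) 𝓘(ℝ, E) (extChartAt 𝓘(ℝ, E) x) x

/-- The form `Ω` written in the preferred chart at `p`, that is, its pullback under the inverse of
that chart. Only its values on the (open) target of the chart are meaningful. -/
def Form.inChart {k : ℕ} (Ω : Form E M k) (p : M) : E → E [⋀^Fin k]→L[ℝ] ℝ := fun y =>
  (Ω ((extChartAt 𝓘(ℝ, E) p).symm y)).compContinuousLinearMap (chartInvDeriv p y)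

/-- A form is smooth if all its chart expressions are smooth. -/
def Form.IsSmooth {k : ℕ} (Ω : Form E M k) : Prop :=
  ∀ p : M, ContDiffOn ℝ ∞ (Ω.inChart p) (extChartAt 𝓘(ℝ, E) p).target

/-- The exterior derivative: at `x`, take the exterior derivative in the chart at `x` and pull the
result back to the tangent space at `x`. -/
def Form.d {k : ℕ} (Ω : Form E M k) : Form E M (k + 1) := fun x =>
  (extDeriv (Ω.inChart x) (extChartAt 𝓘(ℝ, E) x x)).compContinuousLinearMap
    (chartDeriv x)

/-- A symplectic form: a smooth closed nondegenerate 2-form. -/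
structure IsSymplectic (Ω : Form E M 2) : Prop where
  smooth : Ω.IsSmooth
  closed : ∀ x, Ω.d x = 0
  nondegenerate : ∀ (x : M) (v : TangentSpace 𝓘(ℝ, E) x),
    (∀ w : TangentSpace 𝓘(ℝ, E) x, Ω x ![v, w] = 0) → v = 0

end Forms

/-! ### Almost complex structures, the operator `d^c`, potentials and metrics -/

section AlmostComplex

variable {E : Type*} [NormedAddCommGroup E] [NormedSpace ℝ E]
  {M : Type*} [TopologicalSpace M] [ChartedSpace E M]

variable (E M) in
/-- A (not necessarily smooth) field of endomorphisms of the tangent spaces of `M`. -/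
abbrev EndField : Type _ :=
  ∀ x : M, TangentSpace 𝓘(ℝ, E) x →L[ℝ] TangentSpace 𝓘(ℝ, E) x

/-- An almost complex structure: a smooth field of endomorphisms `J` with `J² = -1`. -/
structure IsAlmostComplex [IsManifold 𝓘(ℝ, E) ∞ M] (J : EndField E M) : Prop where
  smooth : ContMDiff 𝓘(ℝ, E) (𝓘(ℝ, E).prod 𝓘(ℝ, E →L[ℝ] E)) ∞
    (fun x => Bundle.TotalSpace.mk' (E →L[ℝ] E)
      (E := fun x : M => TangentSpace 𝓘(ℝ, E) x →L[ℝ] TangentSpace 𝓘(ℝ, E) x) x (J x))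
  sq_eq_neg : ∀ (x : M) (v : TangentSpace 𝓘(ℝ, E) x), J x (J x v) = -v

/-- `Ω` tames `J`: `Ω(X, JX) > 0` for all `X ≠ 0`. -/
def Tames (Ω : Form E M 2) (J : EndField E M) : Prop :=
  ∀ (x : M) (v : TangentSpace 𝓘(ℝ, E) x), v ≠ 0 → 0 < Ω x ![v, J x v]

/-- `J` is compatible with `Ω`: `Ω` tames `J` and `Ω(JX, JY) = Ω(X, Y)`. -/
structure IsCompatible (Ω : Form E M 2) (J : EndField E M) : Prop where
  tames : Tames Ω J
  invariant : ∀ (x : M) (v w : TangentSpace 𝓘(ℝ, E) x), Ω x ![J x v, J x w] = Ω x ![v, w]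

/-- The differential of a real function, as a linear functional on the tangent space. -/
def dfun (ρ : M → ℝ) (x : M) : TangentSpace 𝓘(ℝ, E) x →L[ℝ] ℝ :=
  mfderiv 𝓘(ℝ, E) 𝓘(ℝ, ℝ) ρ x

/-- The 1-form `d^c ρ = √-1 (∂bar ρ - ∂ ρ) = - dρ ∘ J`
(see `dc_eq_I_mul_dbar_sub_del` for the first expression). -/
def dc (J : EndField E M) (ρ : M → ℝ) : Form E M 1 := fun x =>
  ContinuousAlternatingMap.ofSubsingleton ℝ (TangentSpace 𝓘(ℝ, E) x) ℝ 0
    (-((dfun ρ x).comp (J x)))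

/-- If `dρ = ∂ρ + ∂bar ρ` at `x` with `∂ρ` of type (1,0) and `∂bar ρ` of type (0,1), then
`d^c ρ = √-1 (∂bar ρ - ∂ρ)` at `x`. -/
theorem dc_eq_I_mul_dbar_sub_del (J : EndField E M) (ρ : M → ℝ) (x : M)
    (del dbar : TangentSpace 𝓘(ℝ, E) x →L[ℝ] ℂ)
    (h_sum : ∀ v, ((dfun (E := E) ρ x v : ℝ) : ℂ) = del v + dbar v)
    (h_del : ∀ v, del (J x v) = Complex.I * del v)
    (h_dbar : ∀ v, dbar (J x v) = -(Complex.I * dbar v)) (v : TangentSpace 𝓘(ℝ, E) x) :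
    ((dc J ρ x ![v] : ℝ) : ℂ) = Complex.I * (dbar v - del v) := by
  have h1 : dc J ρ x ![v] = -(dfun (E := E) ρ x (J x v)) := rfl
  rw [h1, Complex.ofReal_neg, h_sum, h_del, h_dbar]
  ring

/-- The 2-form `Ω + dd^c ρ`. -/
def omegaRho (Ω : Form E M 2) (J : EndField E M) (ρ : M → ℝ) : Form E M 2 :=
  fun x => Ω x + (dc J ρ).d x

/-- The set of potentials: smooth real functions `ρ` such that `Ω + dd^c ρ` tames `J`. -/
def potentials (Ω : Form E M 2) (J : EndField E M) : Set (M → ℝ) :=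
  {ρ | ContMDiff 𝓘(ℝ, E) 𝓘(ℝ, ℝ) ∞ ρ ∧ Tames (omegaRho Ω J ρ) J}

/-- A field of real-valued functions of two tangent vectors (a covariant 2-tensor). -/
abbrev Tensor2 (E M : Type*) [NormedAddCommGroup E] [NormedSpace ℝ E]
    [TopologicalSpace M] [ChartedSpace E M] : Type _ :=
  ∀ x : M, TangentSpace 𝓘(ℝ, E) x → TangentSpace 𝓘(ℝ, E) x → ℝ

/-- The metric `g_ρ(X, Y) = (Ω_ρ(X, JY) + Ω_ρ(Y, JX)) / 2` associated to a potential `ρ`. -/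
def metricRho (Ω : Form E M 2) (J : EndField E M) (ρ : M → ℝ) : Tensor2 E M := fun x v w =>
  (omegaRho Ω J ρ x ![v, J x w] + omegaRho Ω J ρ x ![w, J x v]) / 2

end AlmostComplex

/-! ### Area of a compact surface with a Riemannian metric -/

section Area

variable {S : Type*} [TopologicalSpace S] [ChartedSpace (EuclideanSpace ℝ (Fin 2)) S]

/-- The Gram matrix `g_ij = g(∂_i, ∂_j)` of a 2-tensor in the preferred chart at `p`, at the point
with coordinates `y`. -/
def gramInChart (g : Tensor2 (EuclideanSpace ℝ (Fin 2)) S) (p : S) (y : EuclideanSpace ℝ (Fin 2)) :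
    Matrix (Fin 2) (Fin 2) ℝ :=
  Matrix.of fun i j =>
    g ((extChartAt (𝓡 2) p).symm y)
      (chartInvDeriv p y (EuclideanSpace.single i (1 : ℝ)))
      (chartInvDeriv p y (EuclideanSpace.single j (1 : ℝ)))

variable [IsManifold (𝓡 2) ∞ S] [T2Space S] [CompactSpace S]

variable (S) in
/-- A smooth partition of unity on `S` such that the function with index `p` is supported in the
domain of the chart at `p`. -/
def chartPartition : SmoothPartitionOfUnity S (𝓡 2) S Set.univ :=
  Classical.choose (SmoothPartitionOfUnity.exists_isSubordinate_chartAt_source (𝓡 2) S)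

theorem chartPartition_isSubordinate :
    (chartPartition S).IsSubordinate
      (fun p => (chartAt (EuclideanSpace ℝ (Fin 2)) p).source) :=
  Classical.choose_spec (SmoothPartitionOfUnity.exists_isSubordinate_chartAt_source (𝓡 2) S)

/-- The area of the compact surface `S` with respect to a Riemannian metric `g`: the integral over
`S` of the density given by `√(det (g_ij)) dx₁ dx₂` in charts, computed with a partition of unity
(only finitely many terms of the sum are nonzero, and the value does not depend on the partition).
No orientation is needed. -/
def area (g : Tensor2 (EuclideanSpace ℝ (Fin 2)) S) : ℝ :=
  ∑ᶠ p : S, ∫ y in (extChartAt (𝓡 2) p).target,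
    chartPartition S p ((extChartAt (𝓡 2) p).symm y) * √((gramInChart g p y).det)

end Area

/-! ### The area functional, its critical points, and `J`-holomorphic immersions -/

section Functional

variable {E : Type*} [NormedAddCommGroup E] [NormedSpace ℝ E]
  {M : Type*} [TopologicalSpace M] [ChartedSpace E M]
  {S : Type*} [TopologicalSpace S] [ChartedSpace (EuclideanSpace ℝ (Fin 2)) S]

/-- The pullback `F^* g` of a covariant 2-tensor under `F : S → M`. -/
def pullback (F : S → M) (g : Tensor2 E M) : Tensor2 (EuclideanSpace ℝ (Fin 2)) S :=
  fun p u v => g (F p) (mfderiv (𝓡 2) 𝓘(ℝ, E) F p u) (mfderiv (𝓡 2) 𝓘(ℝ, E) F p v)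

/-- The area functional `ρ ↦ Area(S, F^* g_ρ)`. -/
def areaFunctional [IsManifold (𝓡 2) ∞ S] [T2Space S] [CompactSpace S]
    (Ω : Form E M 2) (J : EndField E M) (F : S → M) (ρ : M → ℝ) : ℝ :=
  area (pullback F (metricRho Ω J ρ))

/-- `ρ` is a critical point of the area functional: `ρ` is a potential, and for every smooth path
`t ↦ φ t`, `|t| < ε`, of potentials with `φ 0 = ρ`, the area along the path has derivative `0` at
`t = 0`. -/
structure IsCriticalPoint [IsManifold (𝓡 2) ∞ S] [T2Space S] [CompactSpace S]
    (Ω : Form E M 2) (J : EndField E M) (F : S → M) (ρ : M → ℝ) : Prop where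
  mem : ρ ∈ potentials Ω J
  deriv_zero : ∀ (ε : ℝ) (φ : ℝ → M → ℝ), 0 < ε →
    ContMDiffOn (𝓘(ℝ, ℝ).prod 𝓘(ℝ, E)) 𝓘(ℝ, ℝ) ∞ (fun z : ℝ × M => φ z.1 z.2)
      (Set.Ioo (-ε) ε ×ˢ Set.univ) →
    (∀ t ∈ Set.Ioo (-ε) ε, φ t ∈ potentials Ω J) → φ 0 = ρ →
    HasDerivAt (fun t => areaFunctional Ω J F (φ t)) 0 0

/-- `F` is `J`-holomorphic: `J` maps each image `F_*(T_p S)` onto itself. -/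
def IsJHolomorphic (J : EndField E M) (F : S → M) : Prop :=
  ∀ p : S, (J (F p)) '' Set.range (mfderiv (𝓡 2) 𝓘(ℝ, E) F p) =
    Set.range (mfderiv (𝓡 2) 𝓘(ℝ, E) F p)

end Functional

end JCurve

end

/-!
The first variation of the area in the direction of a function `φ = b²`, where `b` is smooth on `M`
and vanishes on the whole image of `F`, can be computed without second derivatives of `b`. At a zero
of `b` one has `dd^c (b²) = 2 db ∧ d^c b` (`JCurve.d_dc_sq`), and `db` vanishes on the tangent planes
of `F`; hence the metric induced on the surface by the potential `ρ + t b²` is `g + 2t β ⊗ β`, where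
`g` is the metric induced by `ρ` and `β` is the restriction of `d^c b` (`JCurve.metricRho_add_sq`).
Its Gram determinant is affine in `t`, with slope `2B`, where `B ≥ 0` and `B > 0` wherever `β ≠ 0`.
The area density is therefore concave in `t` and bounded below by its chord, so the area grows at
least linearly for small `t > 0` as soon as `β` is not identically zero
(`JCurve.not_hasDerivAt_zero_of_density`). For small `t` the function `ρ + t b²` is again a potential
because `M` is compact (`JCurve.exists_potential_path`). So a critical point forces `β = 0` for
every such `b` (`JCurve.not_isCriticalPoint`).

It remains to find `b` with `β ≠ 0` when `F` is not `J`-holomorphic (`JCurve.exists_test_function`).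
Where `J e` is not tangent to the surface for some tangent vector `e`, the normal form of an
immersion gives a function that vanishes on one sheet and whose differential does not vanish on
`J e`. Other sheets of the image may pass through the same point. This is dealt with by moving to a
point of the open set of such points at which the number of preimages is minimal: there all sheets
through the image point coincide locally, by the inverse function theorem
(`JCurve.IsImmersion.exists_single_sheet`), and a cutoff makes the function vanish on the whole image.

Since `Form.d` and the area are defined through the charts preferred at the points, the argument
needs the independence of the exterior derivative of the chart (`JCurve.Form.inChart_d`), from which
the continuity of all the densities follows.
-/

noncomputable section

namespace JCurve

/-! ### Differential forms and endomorphism fields in charts -/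

section ChartCalculus

variable {E : Type*} [NormedAddCommGroup E] [NormedSpace ℝ E]
  {M : Type*} [TopologicalSpace M] [ChartedSpace E M]

theorem extChartAt_target_mem_nhds_of_mem (p : M) {y : E}
    (hy : y ∈ (extChartAt 𝓘(ℝ, E) p).target) : (extChartAt 𝓘(ℝ, E) p).target ∈ 𝓝 y :=
  (isOpen_extChartAt_target p).mem_nhds hy

variable [IsManifold 𝓘(ℝ, E) ∞ M]

theorem mdifferentiableAt_extChartAt_symm (p : M) {y : E}
    (hy : y ∈ (extChartAt 𝓘(ℝ, E) p).target) :
    MDifferentiableAt 𝓘(ℝ, E) 𝓘(ℝ, E) (extChartAt 𝓘(ℝ, E) p).symm y := by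
  have := mdifferentiableWithinAt_extChartAt_symm (I := 𝓘(ℝ, E)) hy
  simpa using! this

variable (E) in
/-- The differential of the chart at `p`, at an arbitrary point `x`. -/
def chartDerivAt (p x : M) : TangentSpace 𝓘(ℝ, E) x →L[ℝ] E :=
  mfderiv 𝓘(ℝ, E) 𝓘(ℝ, E) (extChartAt 𝓘(ℝ, E) p) x

theorem chartDerivAt_chartInvDeriv (p : M) {y : E}
    (hy : y ∈ (extChartAt 𝓘(ℝ, E) p).target) (v : E) :
    chartDerivAt E p ((extChartAt 𝓘(ℝ, E) p).symm y) (chartInvDeriv p y v) = v := by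
  have := mfderiv_extChartAt_comp_mfderivWithin_extChartAt_symm (I := 𝓘(ℝ, E)) hy
  simp only [modelWithCornersSelf_coe, Set.range_id, mfderivWithin_univ] at this
  exact congrArg (fun L => L v) this

theorem chartInvDeriv_chartDerivAt (p : M) {y : E}
    (hy : y ∈ (extChartAt 𝓘(ℝ, E) p).target)
    (v : TangentSpace 𝓘(ℝ, E) ((extChartAt 𝓘(ℝ, E) p).symm y)) :
    chartInvDeriv p y (chartDerivAt E p ((extChartAt 𝓘(ℝ, E) p).symm y) v) = v := by
  have := mfderivWithin_extChartAt_symm_comp_mfderiv_extChartAt (I := 𝓘(ℝ, E)) hy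
  simp only [modelWithCornersSelf_coe, Set.range_id, mfderivWithin_univ] at this
  exact congrArg (fun L => L v) this

/-- The expressions of a form in two charts are related by pullback under the change of charts. -/
theorem Form.inChart_eventuallyEq_pullback {k : ℕ} (α : Form E M k) (p q : M) {z : E}
    (hz : z ∈ (extChartAt 𝓘(ℝ, E) q).target)
    (hzp : (extChartAt 𝓘(ℝ, E) q).symm z ∈ (extChartAt 𝓘(ℝ, E) p).source) :
    α.inChart q =ᶠ[𝓝 z] fun z' =>
      (α.inChart p ((extChartAt 𝓘(ℝ, E) p) ((extChartAt 𝓘(ℝ, E) q).symm z'))).compContinuousLinearMap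
        (fderiv ℝ (extChartAt 𝓘(ℝ, E) p ∘ (extChartAt 𝓘(ℝ, E) q).symm) z') := by
  have h1 : ∀ᶠ z' in 𝓝 z, (extChartAt 𝓘(ℝ, E) q).symm z' ∈ (extChartAt 𝓘(ℝ, E) p).source :=
    (continuousAt_extChartAt_symm'' hz).eventually_mem
      ((isOpen_extChartAt_source p).mem_nhds hzp)
  filter_upwards [h1, extChartAt_target_mem_nhds_of_mem q hz] with z' hz'p hz'
  set x := (extChartAt 𝓘(ℝ, E) q).symm z' with hx
  have hd : fderiv ℝ (extChartAt 𝓘(ℝ, E) p ∘ (extChartAt 𝓘(ℝ, E) q).symm) z' =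
      (chartDerivAt E p x).comp (chartInvDeriv q z') := by
    rw [← mfderiv_eq_fderiv]
    exact mfderiv_comp z' (mdifferentiableAt_extChartAt (by rwa [extChartAt_source] at hz'p))
      (mdifferentiableAt_extChartAt_symm q hz')
  have hy : extChartAt 𝓘(ℝ, E) p x ∈ (extChartAt 𝓘(ℝ, E) p).target :=
    (extChartAt 𝓘(ℝ, E) p).map_source hz'p
  have hsx : (extChartAt 𝓘(ℝ, E) p).symm (extChartAt 𝓘(ℝ, E) p x) = x :=
    (extChartAt 𝓘(ℝ, E) p).left_inv hz'p
  ext v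
  rw [hd]
  -- `x` and its image under chart and inverse chart are equal but not definitionally so; the
  -- statement is therefore generalized over points equal to `x`
  have key : ∀ (x' : M), x' = x → ∀ (L : E →L[ℝ] TangentSpace 𝓘(ℝ, E) x'),
      (∀ w, L (chartDerivAt E p x' w) = w) →
      α x (fun i => chartInvDeriv q z' (v i)) =
      α x' (fun i => L (chartDerivAt E p x (chartInvDeriv q z' (v i)))) := by
    rintro _ rfl L hL
    exact congrArg _ (funext fun i => (hL _).symm)
  exact key _ hsx (chartInvDeriv p (extChartAt 𝓘(ℝ, E) p x)) (chartInvDeriv_chartDerivAt p hy)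

/-- The exterior derivative, defined at each point in the chart preferred at that point, may be
computed in any chart, because `extDeriv` commutes with pullback. -/
theorem Form.inChart_d {k : ℕ} (α : Form E M k) (p : M) {y : E}
    (hy : y ∈ (extChartAt 𝓘(ℝ, E) p).target) (hα : DifferentiableAt ℝ (α.inChart p) y) :
    α.d.inChart p y = extDeriv (α.inChart p) y := by
  set x := (extChartAt 𝓘(ℝ, E) p).symm y with hx
  have hxp : x ∈ (extChartAt 𝓘(ℝ, E) p).source := (extChartAt 𝓘(ℝ, E) p).map_target hy
  have hz : extChartAt 𝓘(ℝ, E) x x ∈ (extChartAt 𝓘(ℝ, E) x).target := mem_extChartAt_target x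
  have hsz : (extChartAt 𝓘(ℝ, E) x).symm (extChartAt 𝓘(ℝ, E) x x) = x := extChartAt_to_inv x
  have hyx : (extChartAt 𝓘(ℝ, E) p) x = y := (extChartAt 𝓘(ℝ, E) p).right_inv hy
  set τ := extChartAt 𝓘(ℝ, E) p ∘ (extChartAt 𝓘(ℝ, E) x).symm with hτ
  have hτz : τ (extChartAt 𝓘(ℝ, E) x x) = y := by simp only [hτ, Function.comp, hsz, hyx]
  have hτs : ContDiffAt ℝ 2 τ (extChartAt 𝓘(ℝ, E) x x) := by
    have h := contDiffWithinAt_ext_coord_change (I := 𝓘(ℝ, E)) (n := 2) p x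
      (y := extChartAt 𝓘(ℝ, E) x x) (by
        rw [PartialEquiv.trans_source, PartialEquiv.symm_source]
        exact ⟨hz, by rw [Set.mem_preimage, hsz]; exact hxp⟩)
    simpa only [modelWithCornersSelf_coe, Set.range_id, contDiffWithinAt_univ] using h
  have e1 := (α.inChart_eventuallyEq_pullback p x hz (by rw [hsz]; exact hxp)).extDeriv_eq
  have e2 := extDeriv_pullback (f := τ) (x := extChartAt 𝓘(ℝ, E) x x)
    (show DifferentiableAt ℝ (α.inChart p) (τ (extChartAt 𝓘(ℝ, E) x x)) by rw [hτz]; exact hα)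
    hτs (by simp)
  rw [hτz] at e2
  have e3 : α.d x = ((extDeriv (α.inChart p) y).compContinuousLinearMap
      (fderiv ℝ τ (extChartAt 𝓘(ℝ, E) x x))).compContinuousLinearMap (chartDeriv x) := by
    rw [Form.d, e1]
    exact congrArg (fun L => ContinuousAlternatingMap.compContinuousLinearMap L (chartDeriv x)) e2
  have hd : ∀ w, fderiv ℝ τ (extChartAt 𝓘(ℝ, E) x x) (chartDeriv x w) = chartDerivAt E p x w := by
    intro w
    have hc : τ ∘ extChartAt 𝓘(ℝ, E) x =ᶠ[𝓝 x] extChartAt 𝓘(ℝ, E) p := by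
      filter_upwards [(isOpen_extChartAt_source (I := 𝓘(ℝ, E)) x).mem_nhds
        (mem_extChartAt_source x)] with x' hx'
      simp only [hτ, Function.comp, (extChartAt 𝓘(ℝ, E) x).left_inv hx']
    have h1 := hc.mfderiv_eq (I := 𝓘(ℝ, E)) (I' := 𝓘(ℝ, E))
    have h2 := mfderiv_comp (I := 𝓘(ℝ, E)) (I' := 𝓘(ℝ, E)) (I'' := 𝓘(ℝ, E)) x (g := τ)
      (f := extChartAt 𝓘(ℝ, E) x)
      (hτs.differentiableAt (by norm_num)).mdifferentiableAt
      (mdifferentiableAt_extChartAt (by simp))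
    rw [h1, mfderiv_eq_fderiv] at h2
    exact (congrArg (fun L => L w) h2).symm
  ext v
  change (α.d x) (fun i => chartInvDeriv p y (v i)) = _
  rw [e3]
  change extDeriv (α.inChart p) y (fun i => fderiv ℝ τ (extChartAt 𝓘(ℝ, E) x x)
    (chartDeriv x (chartInvDeriv p y (v i)))) = _
  congr 1
  funext i
  rw [hd]
  exact chartDerivAt_chartInvDeriv p hy (v i)

/-- The endomorphism field `J` written in the chart at `p`. -/
def EndField.inChart (J : EndField E M) (p : M) (y : E) : E →L[ℝ] E :=
  (chartDerivAt E p ((extChartAt 𝓘(ℝ, E) p).symm y)).comp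
    ((J ((extChartAt 𝓘(ℝ, E) p).symm y)).comp (chartInvDeriv p y))

theorem chartInvDeriv_inChart (J : EndField E M) (p : M) {y : E}
    (hy : y ∈ (extChartAt 𝓘(ℝ, E) p).target) (v : E) :
    chartInvDeriv p y (J.inChart p y v) =
      J ((extChartAt 𝓘(ℝ, E) p).symm y) (chartInvDeriv p y v) :=
  chartInvDeriv_chartDerivAt p hy _

theorem IsAlmostComplex.contDiffOn_inChart {J : EndField E M} (hJ : IsAlmostComplex J) (p : M) :
    ContDiffOn ℝ ∞ (J.inChart p) (extChartAt 𝓘(ℝ, E) p).target := by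
  have h1 := (Bundle.Trivialization.contMDiffOn_section_baseSet_iff (n := ∞) (IB := 𝓘(ℝ, E))
    (trivializationAt (E →L[ℝ] E)
    (fun x : M => TangentSpace 𝓘(ℝ, E) x →L[ℝ] TangentSpace 𝓘(ℝ, E) x) p)
      (s := J)).1 hJ.smooth.contMDiffOn
  have h2 : ContMDiffOn 𝓘(ℝ, E) 𝓘(ℝ, E) ∞ (extChartAt 𝓘(ℝ, E) p).symm
    (extChartAt 𝓘(ℝ, E) p).target := contMDiffOn_extChartAt_symm p
  have h3 := h1.comp h2 (fun y hy => by
    have := (extChartAt 𝓘(ℝ, E) p).map_target hy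
    rw [extChartAt_source] at this
    simpa using! this)
  rw [contMDiffOn_iff_contDiffOn] at h3
  refine h3.congr fun y hy => ?_
  have hs : (extChartAt 𝓘(ℝ, E) p).symm y ∈ (chartAt E p).source := by
    have := (extChartAt 𝓘(ℝ, E) p).map_target hy
    simpa only [extChartAt_source] using this
  simp only [Function.comp, hom_trivializationAt_apply, ContinuousLinearMap.inCoordinates]
  rw [TangentBundle.continuousLinearMapAt_trivializationAt hs,
    TangentBundle.symmL_trivializationAt hs, (extChartAt 𝓘(ℝ, E) p).right_inv hy]
  simp only [modelWithCornersSelf_coe, Set.range_id, mfderivWithin_univ]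
  rfl

theorem dc_inChart (J : EndField E M) {ρ : M → ℝ} (hρ : ContMDiff 𝓘(ℝ, E) 𝓘(ℝ, ℝ) ∞ ρ) (p : M)
    {y : E} (hy : y ∈ (extChartAt 𝓘(ℝ, E) p).target) :
    (dc J ρ).inChart p y = ContinuousAlternatingMap.ofSubsingleton ℝ E ℝ 0
      (-((fderiv ℝ (ρ ∘ (extChartAt 𝓘(ℝ, E) p).symm) y).comp (J.inChart p y))) := by
  have h : fderiv ℝ (ρ ∘ (extChartAt 𝓘(ℝ, E) p).symm) y =
      (dfun (E := E) ρ ((extChartAt 𝓘(ℝ, E) p).symm y) : E →L[ℝ] ℝ).comp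
        (chartInvDeriv p y : E →L[ℝ] E) := by
    rw [← mfderiv_eq_fderiv]
    exact mfderiv_comp y ((hρ _).mdifferentiableAt (by simp))
      (mdifferentiableAt_extChartAt_symm p hy)
  ext v
  rw [h]
  have := chartInvDeriv_inChart J p hy (v 0)
  change -(dfun (E := E) ρ ((extChartAt 𝓘(ℝ, E) p).symm y)
    (J ((extChartAt 𝓘(ℝ, E) p).symm y) (chartInvDeriv p y (v 0)))) = 
    -(dfun (E := E) ρ ((extChartAt 𝓘(ℝ, E) p).symm y)
      (chartInvDeriv p y (J.inChart p y (v 0))))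
  rw [this]

theorem contDiffOn_comp_extChartAt_symm {ρ : M → ℝ} (hρ : ContMDiff 𝓘(ℝ, E) 𝓘(ℝ, ℝ) ∞ ρ) (p : M) :
    ContDiffOn ℝ ∞ (ρ ∘ (extChartAt 𝓘(ℝ, E) p).symm) (extChartAt 𝓘(ℝ, E) p).target := by
  rw [← contMDiffOn_iff_contDiffOn]
  exact hρ.comp_contMDiffOn (contMDiffOn_extChartAt_symm p)

theorem isSmooth_dc {J : EndField E M} (hJ : IsAlmostComplex J) {ρ : M → ℝ}
    (hρ : ContMDiff 𝓘(ℝ, E) 𝓘(ℝ, ℝ) ∞ ρ) : (dc J ρ).IsSmooth := by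
  intro p
  have h1 : ContDiffOn ℝ ∞ (fderiv ℝ (ρ ∘ (extChartAt 𝓘(ℝ, E) p).symm))
      (extChartAt 𝓘(ℝ, E) p).target :=
    (contDiffOn_comp_extChartAt_symm hρ p).fderiv_of_isOpen (isOpen_extChartAt_target p) (by simp)
  have h2 := ((h1.clm_comp (hJ.contDiffOn_inChart p)).neg)
  have h3 := (ContinuousAlternatingMap.ofSubsingletonLIE (𝕜 := ℝ) (E := E) (F := ℝ) (0 : Fin 1)).contDiff.comp_contDiffOn h2
  exact h3.congr fun y hy => dc_inChart J hρ p hy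

omit [IsManifold 𝓘(ℝ, E) ∞ M] in
theorem Form.IsSmooth.differentiableAt {k : ℕ} {α : Form E M k} (hα : α.IsSmooth) (p : M) {y : E}
    (hy : y ∈ (extChartAt 𝓘(ℝ, E) p).target) : DifferentiableAt ℝ (α.inChart p) y :=
  ((hα p).contDiffAt (extChartAt_target_mem_nhds_of_mem p hy)).differentiableAt (by simp)

theorem Form.IsSmooth.d {k : ℕ} {α : Form E M k} (hα : α.IsSmooth) : α.d.IsSmooth := by
  intro p
  have h1 : ContDiffOn ℝ ∞ (fderiv ℝ (α.inChart p)) (extChartAt 𝓘(ℝ, E) p).target :=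
    (hα p).fderiv_of_isOpen (isOpen_extChartAt_target p) (by simp)
  have h2 := (ContinuousAlternatingMap.alternatizeUncurryFinCLM (n := k) ℝ E ℝ).contDiff.comp_contDiffOn h1
  exact h2.congr fun y hy => α.inChart_d p hy (hα.differentiableAt p hy)

omit [IsManifold 𝓘(ℝ, E) ∞ M] in
theorem Form.IsSmooth.add {k : ℕ} {α β : Form E M k} (hα : α.IsSmooth) (hβ : β.IsSmooth) :
    Form.IsSmooth (fun x => α x + β x) :=
  fun p => (hα p).add (hβ p)

theorem isSmooth_omegaRho {Ω : Form E M 2} (hΩ : Ω.IsSmooth) {J : EndField E M}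
    (hJ : IsAlmostComplex J) {ρ : M → ℝ} (hρ : ContMDiff 𝓘(ℝ, E) 𝓘(ℝ, ℝ) ∞ ρ) :
    (omegaRho Ω J ρ).IsSmooth :=
  hΩ.add (isSmooth_dc hJ hρ).d

end ChartCalculus

/-! ### Local structure of immersions -/

section Immersion

universe u

variable {E : Type u} [NormedAddCommGroup E] [NormedSpace ℝ E]
  {V : Type*} [NormedAddCommGroup V] [NormedSpace ℝ V]
  {M : Type*} [TopologicalSpace M] [ChartedSpace E M] [IsManifold 𝓘(ℝ, E) ∞ M]
  {S : Type*} [TopologicalSpace S] [ChartedSpace V S] [IsManifold 𝓘(ℝ, V) ∞ S]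

omit [IsManifold 𝓘(ℝ, V) ∞ S] in
theorem mdifferentiable_of_mem_maximalAtlas {e : OpenPartialHomeomorph S V}
    (he : e ∈ IsManifold.maximalAtlas 𝓘(ℝ, V) ∞ S) : e.MDifferentiable 𝓘(ℝ, V) 𝓘(ℝ, V) :=
  ⟨(contMDiffOn_of_mem_maximalAtlas he).mdifferentiableOn (by simp),
    (contMDiffOn_symm_of_mem_maximalAtlas he).mdifferentiableOn (by simp)⟩

omit [IsManifold 𝓘(ℝ, E) ∞ M] [IsManifold 𝓘(ℝ, V) ∞ S] in
/-- Normal form of an immersion: in suitable charts `F` is `s ↦ (s, 0)`. -/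
theorem IsImmersion.exists_charts {F : S → M}
    (hF : Manifold.IsImmersion 𝓘(ℝ, V) 𝓘(ℝ, E) ∞ F) (y : S) :
    ∃ (C : Type u) (_ : NormedAddCommGroup C) (_ : NormedSpace ℝ C) (Φ : (V × C) ≃L[ℝ] E)
      (c : OpenPartialHomeomorph S V) (e : OpenPartialHomeomorph M E),
      c ∈ IsManifold.maximalAtlas 𝓘(ℝ, V) ∞ S ∧ e ∈ IsManifold.maximalAtlas 𝓘(ℝ, E) ∞ M ∧
      y ∈ c.source ∧ ∀ z ∈ c.source, F z ∈ e.source ∧ e (F z) = Φ (c z, 0) := by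
  have h := hF.isImmersionAt y
  refine ⟨h.complement, inferInstance, inferInstance, h.equiv, h.domChart, h.codChart,
    h.domChart_mem_maximalAtlas, h.codChart_mem_maximalAtlas, h.mem_domChart_source,
    fun z hz => ⟨h.source_subset_preimage_source hz, ?_⟩⟩
  have hzt : h.domChart z ∈ (h.domChart.extend 𝓘(ℝ, V)).target := by
    simpa using h.domChart.map_source hz
  have := h.writtenInCharts hzt
  simpa [h.domChart.left_inv hz] using this

omit [IsManifold 𝓘(ℝ, E) ∞ M] [IsManifold 𝓘(ℝ, V) ∞ S] in
theorem IsImmersion.exists_leftInverse {F : S → M}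
    (hF : Manifold.IsImmersion 𝓘(ℝ, V) 𝓘(ℝ, E) ∞ F) (y : S) :
    ∃ (c : OpenPartialHomeomorph S V) (R : M → V),
      c ∈ IsManifold.maximalAtlas 𝓘(ℝ, V) ∞ S ∧ y ∈ c.source ∧
      ContMDiffAt 𝓘(ℝ, E) 𝓘(ℝ, V) ∞ R (F y) ∧ ∀ z ∈ c.source, R (F z) = c z := by
  obtain ⟨C, _, _, Φ, c, e, hc, he, hy, h⟩ := IsImmersion.exists_charts hF y
  refine ⟨c, fun m => (Φ.symm (e m)).1, hc, hy, ?_, fun z hz => ?_⟩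
  rotate_left
  · change (Φ.symm (e (F z))).1 = c z
    rw [(h z hz).2, Φ.symm_apply_apply]
  have h1 : ContMDiffAt 𝓘(ℝ, E) 𝓘(ℝ, E) ∞ e (F y) :=
    contMDiffAt_of_mem_maximalAtlas he (h y hy).1
  have h2 : ContDiff ℝ ∞ (fun a : E => (Φ.symm a).1) :=
    contDiff_fst.comp Φ.symm.contDiff
  exact h2.contMDiff.contMDiffAt.comp (F y) h1

omit [IsManifold 𝓘(ℝ, E) ∞ M] [IsManifold 𝓘(ℝ, V) ∞ S] in
theorem IsImmersion.injective_mfderiv {F : S → M}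
    (hF : Manifold.IsImmersion 𝓘(ℝ, V) 𝓘(ℝ, E) ∞ F) (y : S) :
    Function.Injective (mfderiv 𝓘(ℝ, V) 𝓘(ℝ, E) F y) := by
  obtain ⟨c, R, hc, hy, hR, h⟩ := IsImmersion.exists_leftInverse hF y
  have h1 : R ∘ F =ᶠ[𝓝 y] c := by
    filter_upwards [c.open_source.mem_nhds hy] with z hz using h z hz
  have h2 := mfderiv_comp (I' := 𝓘(ℝ, E)) y (hR.mdifferentiableAt (by simp))
    ((hF.contMDiff y).mdifferentiableAt (by simp))
  have h3 := (mdifferentiable_of_mem_maximalAtlas hc).mfderiv_injective hy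
  rw [← h1.mfderiv_eq, h2] at h3
  exact Function.Injective.of_comp h3

omit [IsManifold 𝓘(ℝ, E) ∞ M] [IsManifold 𝓘(ℝ, V) ∞ S] in
/-- A tangent vector that is not tangent to the immersed manifold is detected by a function that
vanishes on the sheet through the given point. -/
theorem IsImmersion.exists_function_of_notMem_range {F : S → M}
    (hF : Manifold.IsImmersion 𝓘(ℝ, V) 𝓘(ℝ, E) ∞ F) (y : S) (w : TangentSpace 𝓘(ℝ, E) (F y))
    (hw : w ∉ Set.range (mfderiv 𝓘(ℝ, V) 𝓘(ℝ, E) F y)) :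
    ∃ (u : M → ℝ) (O : Set M), IsOpen O ∧ F y ∈ O ∧ ContMDiffOn 𝓘(ℝ, E) 𝓘(ℝ, ℝ) ∞ u O ∧
      (∀ᶠ z in 𝓝 y, u (F z) = 0) ∧ dfun (E := E) u (F y) w ≠ 0 := by
  obtain ⟨C, _, _, Φ, c, e, hc, he, hy, h⟩ := IsImmersion.exists_charts hF y
  have hFd : MDifferentiableAt 𝓘(ℝ, V) 𝓘(ℝ, E) F y := (hF.contMDiff y).mdifferentiableAt (by simp)
  have hed := mdifferentiable_of_mem_maximalAtlas he
  have hcd := mdifferentiable_of_mem_maximalAtlas hc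
  have h1 : e ∘ F =ᶠ[𝓝 y] (fun s : V => Φ (s, 0)) ∘ c := by
    filter_upwards [c.open_source.mem_nhds hy] with z hz using (h z hz).2
  let ι : V →L[ℝ] E := (Φ : (V × C) →L[ℝ] E).comp (ContinuousLinearMap.inl ℝ V C)
  have hι : (fun s : V => Φ (s, 0)) = ι := by ext s; simp [ι]
  rw [hι] at h1
  have h2 := h1.mfderiv_eq (I := 𝓘(ℝ, V)) (I' := 𝓘(ℝ, E))
  rw [mfderiv_comp y (hed.mdifferentiableAt (h y hy).1) hFd,
    mfderiv_comp (I' := 𝓘(ℝ, V)) y ι.differentiableAt.mdifferentiableAt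
      (hcd.mdifferentiableAt hy), mfderiv_eq_fderiv, ContinuousLinearMap.fderiv] at h2
  -- the component of `de(w)` along the complement does not vanish
  have hne : (Φ.symm (mfderiv 𝓘(ℝ, E) 𝓘(ℝ, E) e (F y) w)).2 ≠ 0 := by
    intro h0
    apply hw
    obtain ⟨v, hv⟩ := hcd.mfderiv_surjective hy
      (Φ.symm (mfderiv 𝓘(ℝ, E) 𝓘(ℝ, E) e (F y) w)).1
    refine ⟨v, hed.mfderiv_injective (h y hy).1 ?_⟩
    have h3 : mfderiv 𝓘(ℝ, E) 𝓘(ℝ, E) e (F y) (mfderiv 𝓘(ℝ, V) 𝓘(ℝ, E) F y v) =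
      ι (mfderiv 𝓘(ℝ, V) 𝓘(ℝ, V) c y v) := congrArg (fun L => L v) h2
    rw [h3, hv]
    change Φ ((Φ.symm (mfderiv 𝓘(ℝ, E) 𝓘(ℝ, E) e (F y) w)).1, 0) = _
    rw [← h0]
    exact Φ.apply_symm_apply _
  obtain ⟨l, hl⟩ := SeparatingDual.exists_ne_zero (R := ℝ) hne
  let L : E →L[ℝ] ℝ := l.comp ((ContinuousLinearMap.snd ℝ V C).comp (Φ.symm : E →L[ℝ] V × C))
  refine ⟨L ∘ e, e.source, e.open_source, (h y hy).1,
    L.contDiff.contMDiff.comp_contMDiffOn (contMDiffOn_of_mem_maximalAtlas he), ?_, ?_⟩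
  · filter_upwards [c.open_source.mem_nhds hy] with z hz
    change l (Φ.symm (e (F z))).2 = 0
    rw [(h z hz).2, Φ.symm_apply_apply, map_zero]
  · rw [dfun, mfderiv_comp (I' := 𝓘(ℝ, E)) (F y) L.differentiableAt.mdifferentiableAt
      (hed.mdifferentiableAt (h y hy).1), mfderiv_eq_fderiv, ContinuousLinearMap.fderiv]
    exact hl

end Immersion

/-! ### Coinciding sheets of an immersion of a compact manifold -/

section Sheets

variable {E : Type*} [NormedAddCommGroup E] [NormedSpace ℝ E]
  {V : Type*} [NormedAddCommGroup V] [NormedSpace ℝ V]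
  {M : Type*} [TopologicalSpace M] [ChartedSpace E M] [IsManifold 𝓘(ℝ, E) ∞ M] [T2Space M]
  {S : Type*} [TopologicalSpace S] [ChartedSpace V S] [IsManifold 𝓘(ℝ, V) ∞ S]
  [CompactSpace S]

theorem exists_nhds_preimage_subset {X Y : Type*} [TopologicalSpace X] [TopologicalSpace Y]
    [CompactSpace X] [T2Space Y] {f : X → Y} (hf : Continuous f) (q : Y) {O : Set X}
    (hO : IsOpen O) (h : f ⁻¹' {q} ⊆ O) : ∃ W ∈ 𝓝 q, f ⁻¹' W ⊆ O := by
  refine ⟨(f '' Oᶜ)ᶜ, (hf.isClosedMap _ hO.isClosed_compl).isOpen_compl.mem_nhds ?_, ?_⟩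
  · rintro ⟨x, hx, rfl⟩
    exact hx (h rfl)
  · intro x hx
    by_contra hxO
    exact hx ⟨x, hxO, rfl⟩

theorem finite_fiber {X Y : Type*} [TopologicalSpace X] [TopologicalSpace Y]
    [CompactSpace X] [T2Space Y] {f : X → Y} (hf : Continuous f)
    (hinj : ∀ x, ∃ D ∈ 𝓝 x, Set.InjOn f D) (q : Y) : (f ⁻¹' {q}).Finite := by
  choose D hD hDi using hinj
  obtain ⟨t, ht⟩ := (isClosed_singleton.preimage hf).isCompact.elim_nhds_subcover D
    (fun x _ => hD x) (s := f ⁻¹' {q})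
  have : f ⁻¹' {q} ⊆ ⋃ x ∈ t, (D x ∩ f ⁻¹' {q}) := by
    intro z hz
    obtain ⟨x, hx, hzx⟩ := Set.mem_iUnion₂.1 (ht.2 hz)
    exact Set.mem_iUnion₂.2 ⟨x, hx, hzx, hz⟩
  refine Set.Finite.subset (t.finite_toSet.biUnion fun x _ => Set.Subsingleton.finite ?_) this
  intro a ha b hb
  exact hDi x ha.1 hb.1 ((ha.2 : f a = q).trans (hb.2 : f b = q).symm)

variable [FiniteDimensional ℝ V] {F : S → M}

omit [T2Space M] [CompactSpace S] [IsManifold 𝓘(ℝ, E) ∞ M] [IsManifold 𝓘(ℝ, V) ∞ S] in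
/-- If a sheet of an immersion near `x` is contained in the sheet near `y`, then both sheets
coincide near `F x = F y`. -/
theorem IsImmersion.image_mem_nhds_of_sheet (hF : Manifold.IsImmersion 𝓘(ℝ, V) 𝓘(ℝ, E) ∞ F)
    {x y : S} (hxy : F y = F x)
    (h : ∀ D ∈ 𝓝 y, ∀ᶠ x' in 𝓝 x, ∃ z ∈ D, F z = F x') {A : Set S} (hA : A ∈ 𝓝 x) :
    {z | F z ∈ F '' A} ∈ 𝓝 y := by
  obtain ⟨c, R, hc, hx, hR, hRF⟩ := IsImmersion.exists_leftInverse hF x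
  obtain ⟨c', R', hc', hy, hR', hRF'⟩ := IsImmersion.exists_leftInverse hF y
  have smooth : ∀ (c : OpenPartialHomeomorph S V) (R' : M → V) (x : S),
      c ∈ IsManifold.maximalAtlas 𝓘(ℝ, V) ∞ S → x ∈ c.source →
      ContMDiffAt 𝓘(ℝ, E) 𝓘(ℝ, V) ∞ R' (F x) →
      ContDiffAt ℝ ∞ (fun a => R' (F (c.symm a))) (c x) := by
    intro c R' x hc hx hR'
    rw [← contMDiffAt_iff_contDiffAt]
    have h1 := contMDiffAt_symm_of_mem_maximalAtlas hc (c.map_source hx)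
    have h2 : ContMDiffAt 𝓘(ℝ, V) 𝓘(ℝ, E) ∞ F (c.symm (c x)) := hF.contMDiff _
    have h3 : ContMDiffAt 𝓘(ℝ, E) 𝓘(ℝ, V) ∞ R' (F (c.symm (c x))) := by
      rwa [c.left_inv hx]
    exact h3.comp (c x) (ContMDiffAt.comp (c x) h2 h1)
  set f : V → V := fun a => R' (F (c.symm a)) with hf
  set g : V → V := fun a => R (F (c'.symm a)) with hg
  have hfs : ContDiffAt ℝ ∞ f (c x) := smooth c R' x hc hx (hxy ▸ hR')
  have hfx : f (c x) = c' y := by simp only [hf, c.left_inv hx, ← hxy, hRF' y hy]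
  have hgs : ContDiffAt ℝ ∞ g (f (c x)) := hfx ▸ smooth c' R y hc' hy (hxy ▸ hR)
  have hev : ∀ᶠ x' in 𝓝 x, x' ∈ A ∧ x' ∈ c.source ∧ ∃ z ∈ c'.source, F z = F x' :=
    (Filter.eventually_mem_set.2 hA).and
      ((c.open_source.eventually_mem hx).and (h _ (c'.open_source.mem_nhds hy)))
  have hsymm : Filter.Tendsto c.symm (𝓝 (c x)) (𝓝 x) := by
    have := c.continuousAt_symm (c.map_source hx)
    rwa [ContinuousAt, c.left_inv hx] at this
  have htgt : ∀ᶠ a in 𝓝 (c x), a ∈ c.target := c.open_target.mem_nhds (c.map_source hx)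
  have hev' := (hsymm.eventually hev).and htgt
  -- `f` is the transition `c' ∘ c⁻¹` read through `F`, and `g` is its left inverse
  have hgf : g ∘ f =ᶠ[𝓝 (c x)] id := by
    filter_upwards [hev'] with a ⟨⟨_, ha, z, hz, hzF⟩, hat⟩
    simp only [hf, hg, Function.comp, id, ← hzF, hRF' z hz, c'.left_inv hz]
    rw [hzF, hRF _ ha, c.right_inv hat]
  have hder : (fderiv ℝ g (f (c x))).comp (fderiv ℝ f (c x)) = ContinuousLinearMap.id ℝ V := by
    rw [← fderiv_comp _ (hgs.differentiableAt (by simp)) (hfs.differentiableAt (by simp)),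
      hgf.fderiv_eq, fderiv_id]
  have hinj : Function.Injective (fderiv ℝ f (c x)) := fun a b hab => by
    have := congrArg (fderiv ℝ g (f (c x))) hab
    rwa [← ContinuousLinearMap.comp_apply, ← ContinuousLinearMap.comp_apply, hder] at this
  have hsurj : (fderiv ℝ f (c x)).range = ⊤ := by
    rw [LinearMap.range_eq_top]
    exact LinearMap.injective_iff_surjective.1 hinj
  have : CompleteSpace V := FiniteDimensional.complete ℝ V
  have hmap := (hfs.hasStrictFDerivAt (by simp)).map_nhds_eq_of_surj hsurj
  rw [hfx] at hmap
  have himg : f '' {a | (c.symm a ∈ A ∧ c.symm a ∈ c.source ∧ ∃ z ∈ c'.source, F z = F (c.symm a)) ∧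
      a ∈ c.target} ∈ 𝓝 (c' y) := by
    rw [← hmap]
    exact Filter.image_mem_map hev'
  filter_upwards [(c'.continuousAt hy).eventually_mem himg, c'.open_source.mem_nhds hy]
    with z' hz' hz's
  obtain ⟨a, ⟨⟨haA, _, z, hz, hzF⟩, _⟩, haz⟩ := hz'
  have h1 : c' z = c' z' := by
    rw [← haz, ← hRF' z hz, hzF]
  have h2 : z = z' := c'.injOn hz hz's h1
  exact ⟨c.symm a, haA, by rw [← hzF, h2]⟩

omit [IsManifold 𝓘(ℝ, E) ∞ M] [IsManifold 𝓘(ℝ, V) ∞ S] in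
/-- A nonempty open set contains a point `x` such that, near `F x`, the whole image of `F` is the
single sheet through `x`. Any point where the number of preimages of `F x` is minimal will do. -/
theorem IsImmersion.exists_single_sheet (hF : Manifold.IsImmersion 𝓘(ℝ, V) 𝓘(ℝ, E) ∞ F)
    {U : Set S} (hU : IsOpen U) (hne : U.Nonempty) :
    ∃ x ∈ U, ∀ A ∈ 𝓝 x, ∃ W ∈ 𝓝 (F x), ∀ z, F z ∈ W → F z ∈ F '' A := by
  have hcont : Continuous F := hF.contMDiff.continuous
  have hinj : ∀ x, ∃ D ∈ 𝓝 x, Set.InjOn F D := by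
    intro x
    obtain ⟨c, R, hc, hx, hR, hRF⟩ := IsImmersion.exists_leftInverse hF x
    refine ⟨c.source, c.open_source.mem_nhds hx, fun a ha b hb hab => c.injOn ha hb ?_⟩
    rw [← hRF a ha, ← hRF b hb, hab]
  have hfin := finite_fiber hcont hinj
  obtain ⟨x, hxU, hmin⟩ : ∃ x ∈ U, ∀ x' ∈ U, (F ⁻¹' {F x}).ncard ≤ (F ⁻¹' {F x'}).ncard := by
    obtain ⟨x, hx, h⟩ := exists_minimalFor_of_wellFoundedLT (· ∈ U)
      (fun x => (F ⁻¹' {F x}).ncard) hne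
    exact ⟨x, hx, fun x' hx' => (le_total _ _).elim id fun h' => h hx' h'⟩
  refine ⟨x, hxU, fun A hA => ?_⟩
  set T := F ⁻¹' {F x} with hT
  have sheet : ∀ y ∈ T, ∀ D ∈ 𝓝 y, ∀ᶠ x' in 𝓝 x, ∃ z ∈ D, F z = F x' := by
    intro y0 hy0 D0 hD0
    classical
    choose D hD hDi using hinj
    -- neighbourhoods of the preimages on which `F` is injective
    let N : S → Set S := fun y => interior (D y) ∩ interior (if y = y0 then D0 else Set.univ)
    have hN : ∀ y, IsOpen (N y) := fun y =>
      isOpen_interior.inter isOpen_interior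
    have hyN : ∀ y, y ∈ N y := by
      intro y
      refine ⟨mem_interior_iff_mem_nhds.2 (hD y), mem_interior_iff_mem_nhds.2 ?_⟩
      split_ifs with h
      · exact h ▸ hD0
      · exact Filter.univ_mem
    obtain ⟨W, hW, hWN⟩ := exists_nhds_preimage_subset hcont (F x)
      (O := ⋃ y ∈ T, N y) (isOpen_biUnion fun y _ => hN y)
      (fun y hy => Set.mem_biUnion hy (hyN y))
    filter_upwards [hcont.continuousAt.eventually_mem hW, hU.mem_nhds hxU] with x' hx'W hx'U
    by_contra hcon
    push Not at hcon
    have hsub : ∀ z ∈ F ⁻¹' {F x'}, ∃ y ∈ T, z ∈ N y := by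
      intro z hz
      have : z ∈ F ⁻¹' W := by
        rw [Set.mem_preimage, (hz : F z = F x')]; exact hx'W
      simpa using hWN this
    -- if no preimage of `F x'` lay in `D0`, there would be fewer of them than preimages of `F x`
    choose! φ hφT hφN using hsub
    have hle : (F ⁻¹' {F x'}).ncard ≤ (T \ {y0}).ncard := by
      refine Set.ncard_le_ncard_of_injOn φ (fun z hz => ⟨hφT z hz, ?_⟩) ?_
        ((hfin (F x)).subset Set.sdiff_subset)
      · intro h0
        have h1 := (hφN z hz).2
        rw [if_pos (Set.mem_singleton_iff.1 h0)] at h1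
        exact hcon z (interior_subset h1) hz
      · intro a ha b hb hab
        have h1 := (hφN a ha).1
        have h2 := (hφN b hb).1
        rw [hab] at h1
        exact hDi _ (interior_subset h1) (interior_subset h2)
          ((ha : F a = F x').trans (hb : F b = F x').symm)
    have hlt : (T \ {y0}).ncard < T.ncard := Set.ncard_sdiff_singleton_lt_of_mem hy0 (hfin (F x))
    exact absurd (hmin x' hx'U) (not_le.2 (hle.trans_lt hlt))
  obtain ⟨W, hW, hWs⟩ := exists_nhds_preimage_subset hcont (F x)
    (O := interior {z | F z ∈ F '' A}) isOpen_interior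
    (fun y hy => mem_interior_iff_mem_nhds.2 (IsImmersion.image_mem_nhds_of_sheet hF hy (sheet y hy) hA))
  exact ⟨W, hW, fun z hz => (interior_subset (hWs hz) :)⟩

end Sheets

/-! ### Continuous tensors, and comparison of forms on a compact manifold -/

section TensorCalculus

variable {E : Type*} [NormedAddCommGroup E] [NormedSpace ℝ E]
  {M : Type*} [TopologicalSpace M] [ChartedSpace E M]

/-- The tensor `Q` in the chart at `p`, as a function of the point and of the two arguments. -/
def Tensor2.inChart (Q : Tensor2 E M) (p : M) (z : E × E × E) : ℝ :=
  Q ((extChartAt 𝓘(ℝ, E) p).symm z.1) (chartInvDeriv p z.1 z.2.1) (chartInvDeriv p z.1 z.2.2)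

/-- A tensor is continuous if its chart expressions are jointly continuous in the point and the
arguments. -/
def Tensor2.IsContinuous (Q : Tensor2 E M) : Prop :=
  ∀ p : M, ContinuousOn (Q.inChart p) ((extChartAt 𝓘(ℝ, E) p).target ×ˢ Set.univ)

variable [IsManifold 𝓘(ℝ, E) ∞ M]

theorem Tensor2.apply_eq_inChart (Q : Tensor2 E M) {p x : M}
    (hx : x ∈ (extChartAt 𝓘(ℝ, E) p).source) (v w : TangentSpace 𝓘(ℝ, E) x) :
    Q x v w = Q.inChart p (extChartAt 𝓘(ℝ, E) p x, chartDerivAt E p x v, chartDerivAt E p x w) := by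
  have key : ∀ (x' : M), x' = x → ∀ (L : E →L[ℝ] TangentSpace 𝓘(ℝ, E) x'),
      (∀ w, L (chartDerivAt E p x' w) = w) →
      Q x v w = Q x' (L (chartDerivAt E p x v)) (L (chartDerivAt E p x w)) := by
    rintro _ rfl L hL
    rw [hL, hL]
  exact key _ ((extChartAt 𝓘(ℝ, E) p).left_inv hx) (chartInvDeriv p (extChartAt 𝓘(ℝ, E) p x))
    (chartInvDeriv_chartDerivAt p ((extChartAt 𝓘(ℝ, E) p).map_source hx))

theorem Form.apply_eq_inChart {k : ℕ} (α : Form E M k) {p x : M}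
    (hx : x ∈ (extChartAt 𝓘(ℝ, E) p).source) (v : Fin k → TangentSpace 𝓘(ℝ, E) x) :
    α x v = α.inChart p (extChartAt 𝓘(ℝ, E) p x) (fun i => chartDerivAt E p x (v i)) := by
  have key : ∀ (x' : M), x' = x → ∀ (L : E →L[ℝ] TangentSpace 𝓘(ℝ, E) x'),
      (∀ w, L (chartDerivAt E p x' w) = w) →
      α x v = α x' (fun i => L (chartDerivAt E p x (v i))) := by
    rintro _ rfl L hL
    exact congrArg _ (funext fun i => (hL _).symm)
  exact key _ ((extChartAt 𝓘(ℝ, E) p).left_inv hx) (chartInvDeriv p (extChartAt 𝓘(ℝ, E) p x))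
    (chartInvDeriv_chartDerivAt p ((extChartAt 𝓘(ℝ, E) p).map_source hx))

/-- The tensor `(v, w) ↦ α(v, Jw)`. -/
def Form.compRight (α : Form E M 2) (J : EndField E M) : Tensor2 E M :=
  fun x v w => α x ![v, J x w]

theorem Form.IsSmooth.isContinuous_compRight {α : Form E M 2} (hα : α.IsSmooth) {J : EndField E M}
    (hJ : IsAlmostComplex J) : (α.compRight J).IsContinuous := by
  intro p
  have h1 : ContinuousOn (fun z : E × E × E => α.inChart p z.1)
      ((extChartAt 𝓘(ℝ, E) p).target ×ˢ Set.univ) :=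
    (hα p).continuousOn.comp continuousOn_fst fun z hz => hz.1
  have h2 : ContinuousOn (fun z : E × E × E => J.inChart p z.1)
      ((extChartAt 𝓘(ℝ, E) p).target ×ˢ Set.univ) :=
    (hJ.contDiffOn_inChart p).continuousOn.comp continuousOn_fst fun z hz => hz.1
  have h3 : ContinuousOn (fun z : E × E × E => J.inChart p z.1 z.2.2)
      ((extChartAt 𝓘(ℝ, E) p).target ×ˢ Set.univ) :=
    h2.clm_apply (continuous_snd.snd.continuousOn)
  have h4 : ContinuousOn (fun z : E × E × E => (![z.2.1, J.inChart p z.1 z.2.2] : Fin 2 → E))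
      ((extChartAt 𝓘(ℝ, E) p).target ×ˢ Set.univ) := by
    rw [continuousOn_pi]
    intro i
    fin_cases i
    · exact continuous_snd.fst.continuousOn
    · exact h3
  refine (h1.eval h4).congr fun z hz => ?_
  change α _ ![chartInvDeriv p z.1 z.2.1, J _ (chartInvDeriv p z.1 z.2.2)] =
    α _ (fun i => chartInvDeriv p z.1 ((![z.2.1, J.inChart p z.1 z.2.2] : Fin 2 → E) i))
  congr 1
  funext i
  fin_cases i
  · rfl
  · exact (chartInvDeriv_inChart J p hz.1 _).symm

theorem isContinuous_metricRho {Ω : Form E M 2} (hΩ : Ω.IsSmooth) {J : EndField E M}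
    (hJ : IsAlmostComplex J) {ρ : M → ℝ} (hρ : ContMDiff 𝓘(ℝ, E) 𝓘(ℝ, ℝ) ∞ ρ) :
    (metricRho Ω J ρ).IsContinuous := by
  intro p
  have h := (isSmooth_omegaRho hΩ hJ hρ).isContinuous_compRight hJ p
  have h' : ContinuousOn (fun z : E × E × E =>
      ((omegaRho Ω J ρ).compRight J).inChart p (z.1, z.2.2, z.2.1))
      ((extChartAt 𝓘(ℝ, E) p).target ×ˢ Set.univ) :=
    h.comp (by fun_prop) fun z hz => ⟨hz.1, trivial⟩
  exact (h.add h').div_const 2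

/-- The square of a 1-form, as a tensor. -/
def Form.sqTensor (α : Form E M 1) : Tensor2 E M := fun x v w => α x ![v] * α x ![w]

omit [IsManifold 𝓘(ℝ, E) ∞ M] in
theorem Form.IsSmooth.isContinuous_sqTensor {α : Form E M 1} (hα : α.IsSmooth) :
    α.sqTensor.IsContinuous := by
  intro p
  have h1 : ContinuousOn (fun z : E × E × E => α.inChart p z.1)
      ((extChartAt 𝓘(ℝ, E) p).target ×ˢ Set.univ) :=
    (hα p).continuousOn.comp continuousOn_fst fun z hz => hz.1
  have h2 : Continuous (fun z : E × E × E => (![z.2.1] : Fin 1 → E)) := by fun_prop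
  have h3 : Continuous (fun z : E × E × E => (![z.2.2] : Fin 1 → E)) := by fun_prop
  refine ((h1.eval h2.continuousOn).mul (h1.eval h3.continuousOn)).congr fun z hz => ?_
  change α _ ![chartInvDeriv p z.1 z.2.1] * α _ ![chartInvDeriv p z.1 z.2.2] =
    α _ (fun i => chartInvDeriv p z.1 ((![z.2.1] : Fin 1 → E) i)) *
    α _ (fun i => chartInvDeriv p z.1 ((![z.2.2] : Fin 1 → E) i))
  congr 2 <;> funext i <;> fin_cases i <;> rfl

/-- The pullback of a continuous tensor under a smooth map has continuous components in charts. -/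
theorem continuousOn_pullback {S : Type*} [TopologicalSpace S]
    [ChartedSpace (EuclideanSpace ℝ (Fin 2)) S] [IsManifold (𝓡 2) ∞ S] {F : S → M}
    (hF : ContMDiff (𝓡 2) 𝓘(ℝ, E) ∞ F) {Q : Tensor2 E M} (hQ : Q.IsContinuous) (p : S)
    (a b : EuclideanSpace ℝ (Fin 2)) :
    ContinuousOn (fun y => pullback F Q ((extChartAt (𝓡 2) p).symm y)
      (chartInvDeriv p y a) (chartInvDeriv p y b)) (extChartAt (𝓡 2) p).target := by
  intro y₀ hy₀
  set q := F ((extChartAt (𝓡 2) p).symm y₀) with hq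
  have hsm : ContMDiffOn (𝓡 2) 𝓘(ℝ, E) ∞ (fun y => F ((extChartAt (𝓡 2) p).symm y))
      (extChartAt (𝓡 2) p).target := hF.comp_contMDiffOn (contMDiffOn_extChartAt_symm p)
  set U := (extChartAt (𝓡 2) p).target ∩
    (fun y => F ((extChartAt (𝓡 2) p).symm y)) ⁻¹' (extChartAt 𝓘(ℝ, E) q).source with hU
  have hUo : IsOpen U := hsm.continuousOn.isOpen_inter_preimage (isOpen_extChartAt_target p)
    (isOpen_extChartAt_source q)
  have hyU : y₀ ∈ U := ⟨hy₀, mem_extChartAt_source q⟩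
  set ψ : EuclideanSpace ℝ (Fin 2) → E := fun y =>
    extChartAt 𝓘(ℝ, E) q (F ((extChartAt (𝓡 2) p).symm y)) with hψ
  have hψs : ContDiffOn ℝ ∞ ψ U := by
    rw [← contMDiffOn_iff_contDiffOn]
    refine (contMDiffOn_extChartAt (I := 𝓘(ℝ, E)) (x := q)).comp
      (hsm.mono Set.inter_subset_left) fun y hy => ?_
    have := hy.2
    rwa [Set.mem_preimage, extChartAt_source] at this
  have hdψ : ContinuousOn (fderiv ℝ ψ) U := hψs.continuousOn_fderiv_of_isOpen hUo (by simp)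
  have hcont : ContinuousOn (fun y => Q.inChart q (ψ y, fderiv ℝ ψ y a, fderiv ℝ ψ y b)) U := by
    refine (hQ q).comp (hψs.continuousOn.prodMk ((hdψ.clm_apply continuousOn_const).prodMk
      (hdψ.clm_apply continuousOn_const))) fun y hy => ⟨?_, trivial⟩
    exact (extChartAt 𝓘(ℝ, E) q).map_source hy.2
  have hder : ∀ y ∈ U, ∀ v, fderiv ℝ ψ y v = chartDerivAt E q (F ((extChartAt (𝓡 2) p).symm y))
      (mfderiv (𝓡 2) 𝓘(ℝ, E) F ((extChartAt (𝓡 2) p).symm y) (chartInvDeriv p y v)) := by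
    intro y hy v
    have h1 : MDifferentiableAt (𝓡 2) 𝓘(ℝ, E) F ((extChartAt (𝓡 2) p).symm y) :=
      (hF _).mdifferentiableAt (by simp)
    have h2 := mdifferentiableAt_extChartAt_symm p hy.1
    have h3 : MDifferentiableAt 𝓘(ℝ, E) 𝓘(ℝ, E) (extChartAt 𝓘(ℝ, E) q)
        (F ((extChartAt (𝓡 2) p).symm y)) := by
      refine mdifferentiableAt_extChartAt ?_
      have := hy.2
      rwa [Set.mem_preimage, extChartAt_source] at this
    have h4 := mfderiv_comp (I' := 𝓡 2) (I'' := 𝓘(ℝ, E)) y h1 h2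
    have h5 := mfderiv_comp (I' := 𝓘(ℝ, E)) (I'' := 𝓘(ℝ, E)) y (f := F ∘ (extChartAt (𝓡 2) p).symm)
      h3 (h1.comp y h2)
    rw [h4] at h5
    rw [← mfderiv_eq_fderiv]
    exact congrArg (fun L => L v) h5
  refine ((hcont.congr fun y hy => ?_).continuousAt (hUo.mem_nhds hyU)).continuousWithinAt
  rw [hder y hy, hder y hy]
  exact Q.apply_eq_inChart hy.2 _ _

omit [IsManifold 𝓘(ℝ, E) ∞ M] in
theorem Form.apply_smul_smul (α : Form E M 2) (J : EndField E M) (x : M) (c : ℝ)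
    (v : TangentSpace 𝓘(ℝ, E) x) :
    α x ![c • v, J x (c • v)] = c ^ 2 * α x ![v, J x v] := by
  have h1 : (![c • v, J x (c • v)] : Fin 2 → TangentSpace 𝓘(ℝ, E) x) =
      fun i => (fun _ => c : Fin 2 → ℝ) i • (![v, J x v] : Fin 2 → TangentSpace 𝓘(ℝ, E) x) i := by
    funext i
    fin_cases i
    · rfl
    · exact map_smul (J x) c v
  rw [h1, ContinuousAlternatingMap.map_smul_univ]
  simp

/-- On a compact manifold, a smooth 2-form is dominated by a taming one on `J`-complex lines. -/
theorem exists_bound_of_tames [FiniteDimensional ℝ E] [CompactSpace M] {η α : Form E M 2}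
    (hη : η.IsSmooth) (hα : α.IsSmooth) {J : EndField E M} (hJ : IsAlmostComplex J)
    (ht : Tames η J) :
    ∃ C : ℝ, ∀ (x : M) (v : TangentSpace 𝓘(ℝ, E) x), |α x ![v, J x v]| ≤ C * η x ![v, J x v] := by
  have hnn : ∀ (x : M) (v : TangentSpace 𝓘(ℝ, E) x), 0 ≤ η x ![v, J x v] := by
    intro x v
    by_cases hv : v = 0
    · rw [hv, (η x).map_coord_zero (m := ![0, J x 0]) 0 rfl]
    · exact (ht x v hv).le
  have hloc : ∀ x₀ : M, ∃ N ∈ 𝓝 x₀, ∃ C : ℝ, ∀ x ∈ N, ∀ (v : TangentSpace 𝓘(ℝ, E) x),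
      |α x ![v, J x v]| ≤ C * η x ![v, J x v] := by
    intro x₀
    obtain ⟨K, hK, hKt, hKc⟩ := local_compact_nhds
      (extChartAt_target_mem_nhds_of_mem x₀ (mem_extChartAt_target (I := 𝓘(ℝ, E)) x₀))
    set a := (α.compRight J).inChart x₀ with ha
    set e := (η.compRight J).inChart x₀ with he
    have hmaps : Set.MapsTo (fun z : E × E => (z.1, z.2, z.2)) (K ×ˢ Metric.sphere (0 : E) 1)
        ((extChartAt 𝓘(ℝ, E) x₀).target ×ˢ Set.univ) := fun z hz => ⟨hKt hz.1, trivial⟩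
    have hac : ContinuousOn (fun z : E × E => a (z.1, z.2, z.2)) (K ×ˢ Metric.sphere (0 : E) 1) :=
      (hα.isContinuous_compRight hJ x₀).comp (by fun_prop) hmaps
    have hec : ContinuousOn (fun z : E × E => e (z.1, z.2, z.2)) (K ×ˢ Metric.sphere (0 : E) 1) :=
      (hη.isContinuous_compRight hJ x₀).comp (by fun_prop) hmaps
    have hpos : ∀ z ∈ K ×ˢ Metric.sphere (0 : E) 1, 0 < e (z.1, z.2, z.2) := by
      intro z hz
      refine ht _ _ fun h0 => ?_
      have h1 := chartDerivAt_chartInvDeriv x₀ (hKt hz.1) z.2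
      rw [h0, map_zero] at h1
      have h2 := hz.2
      rw [← h1] at h2
      simp at h2
    -- by homogeneity it suffices to bound the quotient on unit vectors over a compact set
    obtain ⟨C, hC⟩ := (hKc.prod (isCompact_sphere (0 : E) 1)).exists_bound_of_continuousOn
      (hac.div hec fun z hz => (hpos z hz).ne')
    refine ⟨(extChartAt 𝓘(ℝ, E) x₀).source ∩ extChartAt 𝓘(ℝ, E) x₀ ⁻¹' K,
      Filter.inter_mem (extChartAt_source_mem_nhds x₀) ((continuousAt_extChartAt x₀) hK),
      C, fun x hx v => ?_⟩
    have hchart : ∀ (β : Form E M 2) (v : TangentSpace 𝓘(ℝ, E) x), β x ![v, J x v] =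
        (β.compRight J).inChart x₀
          (extChartAt 𝓘(ℝ, E) x₀ x, chartDerivAt E x₀ x v, chartDerivAt E x₀ x v) :=
      fun β v => (β.compRight J).apply_eq_inChart hx.1 v v
    set u := chartDerivAt E x₀ x v with hu
    by_cases hu0 : u = 0
    · have h1 := hchart α v
      have h2 := hchart α 0
      have h3 := hchart η v
      have h4 := hchart η 0
      have h0 : chartDerivAt E x₀ x 0 = 0 := map_zero _
      rw [h0] at h2 h4
      rw [← hu, hu0] at h1 h3
      rw [h1, h3, ← h2, ← h4, (η x).map_coord_zero (m := ![0, J x 0]) 0 rfl,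
        (α x).map_coord_zero (m := ![0, J x 0]) 0 rfl]
      simp
    · have hun : 0 < ‖u‖ := norm_pos_iff.2 hu0
      have hz : (extChartAt 𝓘(ℝ, E) x₀ x, ‖u‖⁻¹ • u) ∈ K ×ˢ Metric.sphere (0 : E) 1 := by
        refine ⟨hx.2, ?_⟩
        rw [mem_sphere_zero_iff_norm, norm_smul, norm_inv, norm_norm, inv_mul_cancel₀ hun.ne']
      have h1 := hC _ hz
      have h2 := hpos _ hz
      have h3 : chartDerivAt E x₀ x (‖u‖⁻¹ • v) = ‖u‖⁻¹ • u := map_smul _ _ _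
      have h4 := hchart α (‖u‖⁻¹ • v)
      have h5 := hchart η (‖u‖⁻¹ • v)
      rw [h3, Form.apply_smul_smul] at h4 h5
      simp only [ha, he, ← h4, ← h5, Real.norm_eq_abs, Pi.div_apply] at h1 h2
      have hc : 0 < (‖u‖⁻¹) ^ 2 := by positivity
      rw [abs_div, abs_of_pos h2, div_le_iff₀ h2, abs_mul, abs_of_pos hc] at h1
      refine le_of_mul_le_mul_left ?_ hc
      linarith
  choose N hN C hC using hloc
  obtain ⟨t, ht'⟩ := CompactSpace.elim_nhds_subcover N hN
  refine ⟨∑ x ∈ t, |C x|, fun x v => ?_⟩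
  obtain ⟨x₀, hx₀, hx⟩ : ∃ x₀ ∈ t, x ∈ N x₀ := by
    have : x ∈ ⋃ x ∈ t, N x := ht' ▸ Set.mem_univ x
    simpa using this
  refine (hC x₀ x hx v).trans (mul_le_mul_of_nonneg_right ?_ (hnn x v))
  exact (le_abs_self _).trans
    (Finset.single_le_sum (f := fun x => |C x|) (fun i _ => abs_nonneg _) hx₀)

end TensorCalculus

/-! ### Variation of the potential -/

section Potentials

variable {E : Type*} [NormedAddCommGroup E] [NormedSpace ℝ E]
  {M : Type*} [TopologicalSpace M] [ChartedSpace E M] [IsManifold 𝓘(ℝ, E) ∞ M]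

theorem omegaRho_add_smul (Ω : Form E M 2) {J : EndField E M} (hJ : IsAlmostComplex J)
    {ρ φ : M → ℝ} (hρ : ContMDiff 𝓘(ℝ, E) 𝓘(ℝ, ℝ) ∞ ρ) (hφ : ContMDiff 𝓘(ℝ, E) 𝓘(ℝ, ℝ) ∞ φ)
    (t : ℝ) (x : M) :
    omegaRho Ω J (fun x => ρ x + t * φ x) x = omegaRho Ω J ρ x + t • (dc J φ).d x := by
  have h1 : dc J (fun x => ρ x + t * φ x) = fun x => dc J ρ x + t • dc J φ x := by
    funext x
    have h : dfun (E := E) (fun x => ρ x + t * φ x) x = dfun (E := E) ρ x + t • dfun (E := E) φ x := by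
      have hr := ((hρ x).mdifferentiableAt (by simp)).hasMFDerivAt
      have hp := ((hφ x).mdifferentiableAt (by simp)).hasMFDerivAt
      exact (hr.add (hp.const_smul t)).mfderiv
    ext v
    change -(dfun (E := E) (fun x => ρ x + t * φ x) x (J x (v 0))) =
      -(dfun (E := E) ρ x (J x (v 0))) + t * -(dfun (E := E) φ x (J x (v 0)))
    rw [h]
    change -(dfun (E := E) ρ x (J x (v 0)) + t * dfun (E := E) φ x (J x (v 0))) = _
    ring
  have h2 : (Form.inChart (fun x => dc J ρ x + t • dc J φ x) x : E → E [⋀^Fin 1]→L[ℝ] ℝ) =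
      (dc J ρ).inChart x + t • (dc J φ).inChart x := rfl
  have d1 := (isSmooth_dc hJ hρ).differentiableAt x (mem_extChartAt_target (I := 𝓘(ℝ, E)) x)
  have d2 := (isSmooth_dc hJ hφ).differentiableAt x (mem_extChartAt_target (I := 𝓘(ℝ, E)) x)
  rw [omegaRho, h1, Form.d, h2, extDeriv_add d1 (d2.const_smul t), extDeriv_smul, omegaRho, add_assoc]
  rfl

theorem extDeriv_smul_oneForm_apply {E : Type*} [NormedAddCommGroup E] [NormedSpace ℝ E]
    {f : E → ℝ} {A : E → E [⋀^Fin 1]→L[ℝ] ℝ} {y : E} (hf : DifferentiableAt ℝ f y)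
    (hA : DifferentiableAt ℝ A y) (h0 : f y = 0) (u : Fin 2 → E) :
    extDeriv (fun z => f z • A z) y u =
      fderiv ℝ f y (u 0) * A y ![u 1] - fderiv ℝ f y (u 1) * A y ![u 0] := by
  have h : HasFDerivAt (fun z => f z • A z)
      (f y • fderiv ℝ A y + (fderiv ℝ f y).smulRight (A y)) y :=
    hf.hasFDerivAt.smul hA.hasFDerivAt
  have r0 : Fin.removeNth 0 u = ![u 1] := by
    funext i; fin_cases i; rfl
  have r1 : Fin.removeNth 1 u = ![u 0] := by
    funext i; fin_cases i; rfl
  rw [extDeriv, h.fderiv, ContinuousAlternatingMap.alternatizeUncurryFin_apply, Fin.sum_univ_two,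
    r0, r1]
  simp [h0, sub_eq_add_neg]

/-- At a zero of `b`, the form `dd^c (b²)` is `2 db ∧ d^c b`. -/
theorem d_dc_sq {J : EndField E M} (hJ : IsAlmostComplex J) {b : M → ℝ}
    (hb : ContMDiff 𝓘(ℝ, E) 𝓘(ℝ, ℝ) ∞ b) {x : M} (hx : b x = 0)
    (v w : TangentSpace 𝓘(ℝ, E) x) :
    (dc J (fun x => b x ^ 2)).d x ![v, w] =
      2 * (dfun (E := E) b x v * dc J b x ![w] - dfun (E := E) b x w * dc J b x ![v]) := by
  have h1 : dc J (fun x => b x ^ 2) = fun x => (2 * b x) • dc J b x := by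
    funext x
    have h : dfun (E := E) (fun x => b x ^ 2) x = (2 * b x) • dfun (E := E) b x := by
      have hr := ((hb x).mdifferentiableAt (by simp)).hasMFDerivAt
      have hp : HasMFDerivAt 𝓘(ℝ, ℝ) 𝓘(ℝ, ℝ) (fun s : ℝ => s ^ 2) (b x) _ :=
        ((hasDerivAt_pow 2 (b x)).hasFDerivAt).hasMFDerivAt
      refine (hp.comp x hr).mfderiv.trans ?_
      ext v
      change dfun (E := E) b x v * _ = (2 * b x) * dfun (E := E) b x v
      simp
      ring
    ext v
    change -(dfun (E := E) (fun x => b x ^ 2) x (J x (v 0))) =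
      (2 * b x) * -(dfun (E := E) b x (J x (v 0)))
    rw [h]
    change -((2 * b x) * dfun (E := E) b x (J x (v 0))) = _
    ring
  set y := extChartAt 𝓘(ℝ, E) x x with hy
  have hxs := mem_extChartAt_source (I := 𝓘(ℝ, E)) x
  have hyt := mem_extChartAt_target (I := 𝓘(ℝ, E)) x
  set f : E → ℝ := b ∘ (extChartAt 𝓘(ℝ, E) x).symm with hf
  set A := (dc J b).inChart x with hA
  have h2 : (Form.inChart (fun x => (2 * b x) • dc J b x) x : E → E [⋀^Fin 1]→L[ℝ] ℝ) =
      fun z => (2 * f z) • A z := rfl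
  have dA : DifferentiableAt ℝ A y := (isSmooth_dc hJ hb).differentiableAt x hyt
  have df : DifferentiableAt ℝ f y := ((contDiffOn_comp_extChartAt_symm hb x).contDiffAt
    (extChartAt_target_mem_nhds_of_mem x hyt)).differentiableAt (by simp)
  have hfy : f y = 0 := by simp only [hf, hy, Function.comp, extChartAt_to_inv, hx]
  have hdf : ∀ v, fderiv ℝ f y (chartDerivAt E x x v) = dfun (E := E) b x v := by
    intro v
    have hc : f ∘ extChartAt 𝓘(ℝ, E) x =ᶠ[𝓝 x] b := by
      filter_upwards [(isOpen_extChartAt_source (I := 𝓘(ℝ, E)) x).mem_nhds hxs] with x' hx'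
      simp only [hf, Function.comp, (extChartAt 𝓘(ℝ, E) x).left_inv hx']
    have e1 := hc.mfderiv_eq (I := 𝓘(ℝ, E)) (I' := 𝓘(ℝ, ℝ))
    rw [mfderiv_comp (I' := 𝓘(ℝ, E)) x (f := extChartAt 𝓘(ℝ, E) x) df.mdifferentiableAt
      (mdifferentiableAt_extChartAt (mem_chart_source E x)), mfderiv_eq_fderiv] at e1
    exact congrArg (fun L => L v) e1
  have hAv : ∀ v : TangentSpace 𝓘(ℝ, E) x, A y ![chartDerivAt E x x v] = dc J b x ![v] := by
    intro v
    rw [Form.apply_eq_inChart _ hxs]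
    congr 1
    funext i
    fin_cases i
    rfl
  have hf2 : ∀ u, fderiv ℝ (fun z => 2 * f z) y u = 2 * fderiv ℝ f y u := fun u => by
    rw [(df.hasFDerivAt.const_mul 2).fderiv]
    rfl
  rw [h1]
  change extDeriv (Form.inChart (fun x => (2 * b x) • dc J b x) x) y
    (fun i => chartDeriv x ((![v, w] : Fin 2 → TangentSpace 𝓘(ℝ, E) x) i)) = _
  rw [h2, extDeriv_smul_oneForm_apply (df.const_mul 2) dA (by rw [hfy, mul_zero]), hf2, hf2]
  change (2 * fderiv ℝ f y (chartDerivAt E x x v)) * A y ![chartDerivAt E x x w] -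
    (2 * fderiv ℝ f y (chartDerivAt E x x w)) * A y ![chartDerivAt E x x v] = _
  rw [hdf, hdf, hAv, hAv]
  ring

/-- Being a potential is an open condition along a straight line, by compactness of `M`. -/
theorem exists_potential_path [FiniteDimensional ℝ E] [CompactSpace M] {Ω : Form E M 2}
    (hΩ : Ω.IsSmooth) {J : EndField E M} (hJ : IsAlmostComplex J) {ρ φ : M → ℝ}
    (hρ : ρ ∈ potentials Ω J) (hφ : ContMDiff 𝓘(ℝ, E) 𝓘(ℝ, ℝ) ∞ φ) :
    ∃ ε > 0, ∀ t ∈ Set.Ioo (-ε) ε, (fun x => ρ x + t * φ x) ∈ potentials Ω J := by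
  obtain ⟨C, hC⟩ := exists_bound_of_tames (isSmooth_omegaRho hΩ hJ hρ.1)
    (isSmooth_dc hJ hφ).d hJ hρ.2
  refine ⟨1 / (|C| + 1), by positivity, fun t ht => ⟨?_, fun x v hv => ?_⟩⟩
  · exact hρ.1.add (contMDiff_const.mul hφ)
  · rw [omegaRho_add_smul Ω hJ hρ.1 hφ]
    change 0 < omegaRho Ω J ρ x ![v, J x v] + t * (dc J φ).d x ![v, J x v]
    have h0 := hρ.2 x v hv
    have h1 : |t * (dc J φ).d x ![v, J x v]| ≤ |t| * (|C| * omegaRho Ω J ρ x ![v, J x v]) := by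
      rw [abs_mul]
      refine mul_le_mul_of_nonneg_left ((hC x v).trans ?_) (abs_nonneg t)
      exact mul_le_mul_of_nonneg_right (le_abs_self C) h0.le
    have h2 : |t| * (|C| + 1) < 1 := by
      rw [← lt_div_iff₀ (by positivity)]
      exact abs_lt.2 ht
    have h3 := neg_abs_le (t * (dc J φ).d x ![v, J x v])
    nlinarith [abs_nonneg t]

end Potentials

/-! ### Functions vanishing along a surface that is not `J`-holomorphic -/

section TestFunctions

variable {E : Type*} [NormedAddCommGroup E] [NormedSpace ℝ E] [FiniteDimensional ℝ E]
  {M : Type*} [TopologicalSpace M] [ChartedSpace E M] [IsManifold 𝓘(ℝ, E) ∞ M] [T2Space M]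

/-- A function that is smooth on a neighbourhood `O` of `q` agrees near `q` with a globally smooth
function that vanishes outside `O` and where `u` vanishes. -/
theorem exists_smooth_extension {u : M → ℝ} {O : Set M} {q : M} (hO : IsOpen O) (hq : q ∈ O)
    (hu : ContMDiffOn 𝓘(ℝ, E) 𝓘(ℝ, ℝ) ∞ u O) :
    ∃ b : M → ℝ, ContMDiff 𝓘(ℝ, E) 𝓘(ℝ, ℝ) ∞ b ∧ b =ᶠ[𝓝 q] u ∧
      ∀ x, (x ∈ O → u x = 0) → b x = 0 := by
  obtain ⟨f, -, hf⟩ := (SmoothBumpFunction.nhds_basis_tsupport (I := 𝓘(ℝ, E)) q).mem_iff.1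
    (hO.mem_nhds hq)
  refine ⟨fun x => f x * u x, ?_, ?_, ?_⟩
  · refine contMDiff_of_tsupport fun x hx => ?_
    have hxO : x ∈ O := hf (tsupport_mul_subset_left hx)
    exact f.contMDiffAt.mul (hu.contMDiffAt (hO.mem_nhds hxO))
  · filter_upwards [f.eventuallyEq_one] with x hx
    simp [hx]
  · intro x hx
    by_cases hxO : x ∈ O
    · simp [hx hxO]
    · have : f x = 0 := image_eq_zero_of_notMem_tsupport fun h => hxO (hf h)
      simp [this]

variable {S : Type*} [TopologicalSpace S] [ChartedSpace (EuclideanSpace ℝ (Fin 2)) S]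

omit [FiniteDimensional ℝ E] [IsManifold 𝓘(ℝ, E) ∞ M] [T2Space M] in
theorem dc_congr (J : EndField E M) {b b' : M → ℝ} {x : M} (h : b =ᶠ[𝓝 x] b') :
    dc J b x = dc J b' x := by
  rw [dc, dc, dfun, dfun, h.mfderiv_eq]

/-- The points `p` of `S` at which some smooth function `b` on `M`, vanishing along `F` near `p`,
has `d^c b ≠ 0` on the tangent plane of `F` at `p`. -/
def detected (J : EndField E M) (F : S → M) : Set S :=
  {p | ∃ b : M → ℝ, ContMDiff 𝓘(ℝ, E) 𝓘(ℝ, ℝ) ∞ b ∧ (∀ᶠ z in 𝓝 p, b (F z) = 0) ∧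
    ∃ e, dc J b (F p) ![mfderiv (𝓡 2) 𝓘(ℝ, E) F p e] ≠ 0}

/-- A point where `J` does not preserve the tangent plane is detected. -/
theorem mem_detected {J : EndField E M} {F : S → M}
    (hF : Manifold.IsImmersion (𝓡 2) 𝓘(ℝ, E) ∞ F) {p : S} {e : TangentSpace (𝓡 2) p}
    (he : J (F p) (mfderiv (𝓡 2) 𝓘(ℝ, E) F p e) ∉ Set.range (mfderiv (𝓡 2) 𝓘(ℝ, E) F p)) :
    p ∈ detected J F := by
  obtain ⟨u, O, hO, hp, hu, hu0, hne⟩ := IsImmersion.exists_function_of_notMem_range hF p _ he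
  obtain ⟨b, hb, hbu, -⟩ := exists_smooth_extension hO hp hu
  refine ⟨b, hb, ?_, e, ?_⟩
  · filter_upwards [hu0, hF.contMDiff.continuous.continuousAt.eventually hbu] with z hz hz'
    exact hz'.trans hz
  · rw [dc_congr J hbu]
    exact neg_ne_zero.2 hne

omit [FiniteDimensional ℝ E] [T2Space M] in
theorem isOpen_detected [IsManifold (𝓡 2) ∞ S] {J : EndField E M} (hJ : IsAlmostComplex J)
    {F : S → M} (hF : ContMDiff (𝓡 2) 𝓘(ℝ, E) ∞ F) : IsOpen (detected J F) := by
  rw [isOpen_iff_mem_nhds]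
  rintro p ⟨b, hb, hb0, e, he⟩
  have hps := mem_extChartAt_source (I := 𝓡 2) p
  set e' := chartDerivAt (EuclideanSpace ℝ (Fin 2)) p p e with he'
  set Q := (dc J b).sqTensor with hQ
  have hc := continuousOn_pullback hF (isSmooth_dc hJ hb).isContinuous_sqTensor p e' e'
  have hc' := (hc.continuousAt (extChartAt_target_mem_nhds_of_mem p
    (mem_extChartAt_target (I := 𝓡 2) p))).comp (continuousAt_extChartAt (I := 𝓡 2) p)
  have h0 : (pullback F Q) p e e ≠ 0 := mul_ne_zero he he
  rw [(pullback F Q).apply_eq_inChart hps] at h0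
  filter_upwards [hc'.eventually_ne h0, eventually_eventually_nhds.2 hb0,
    extChartAt_source_mem_nhds (I := 𝓡 2) p] with p' hp' hbp' hps'
  refine ⟨b, hb, hbp', ?_⟩
  have h1 : ∃ e, dc J b (F ((extChartAt (𝓡 2) p).symm (extChartAt (𝓡 2) p p')))
      ![mfderiv (𝓡 2) 𝓘(ℝ, E) F ((extChartAt (𝓡 2) p).symm (extChartAt (𝓡 2) p p')) e] ≠ 0 :=
    ⟨_, left_ne_zero_of_mul hp'⟩
  rwa [(extChartAt (𝓡 2) p).left_inv hps'] at h1

/-- If `F` is not `J`-holomorphic, some smooth function `b` vanishes on the whole image of `F` while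
`d^c b` does not vanish on all its tangent planes. -/
theorem exists_test_function [IsManifold (𝓡 2) ∞ S] [CompactSpace S] {J : EndField E M}
    (hJ : IsAlmostComplex J) {F : S → M}
    (hF : Manifold.IsImmersion (𝓡 2) 𝓘(ℝ, E) ∞ F) (hne : ¬ IsJHolomorphic J F) :
    ∃ b : M → ℝ, ContMDiff 𝓘(ℝ, E) 𝓘(ℝ, ℝ) ∞ b ∧ (∀ z, b (F z) = 0) ∧
      ∃ p e, dc J b (F p) ![mfderiv (𝓡 2) 𝓘(ℝ, E) F p e] ≠ 0 := by
  have hU : (detected J F).Nonempty := by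
    by_contra hcon
    rw [Set.not_nonempty_iff_eq_empty] at hcon
    have hin : ∀ p e, J (F p) (mfderiv (𝓡 2) 𝓘(ℝ, E) F p e) ∈
        Set.range (mfderiv (𝓡 2) 𝓘(ℝ, E) F p) := by
      intro p e
      by_contra h
      have := mem_detected hF h
      rw [hcon] at this
      exact this
    refine hne fun p => Set.Subset.antisymm ?_ ?_
    · rintro _ ⟨_, ⟨e, rfl⟩, rfl⟩
      exact hin p e
    · rintro _ ⟨e, rfl⟩
      obtain ⟨e', he'⟩ := hin p e
      refine ⟨_, ⟨-e', rfl⟩, ?_⟩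
      rw [map_neg, map_neg, he', hJ.sq_eq_neg, neg_neg]
  obtain ⟨x, ⟨b₀, hb₀, hb0, e, he⟩, hx⟩ := IsImmersion.exists_single_sheet hF
    (isOpen_detected hJ hF.contMDiff) hU
  obtain ⟨W, hW, hWF⟩ := hx _ hb0
  obtain ⟨b, hb, hbb, hbW⟩ := exists_smooth_extension (E := E) (u := b₀) isOpen_interior
    (mem_interior_iff_mem_nhds.2 hW) hb₀.contMDiffOn
  refine ⟨b, hb, fun z => hbW _ fun hz => ?_, x, e, ?_⟩
  · obtain ⟨z', hz', hzz'⟩ := hWF z (interior_subset hz)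
    rw [← hzz']
    exact hz'
  · rwa [dc_congr J hbb]

end TestFunctions

/-! ### Growth of the area integral -/

section Area

open MeasureTheory

theorem det_nonneg_of_quadratic_nonneg {a b c : ℝ}
    (h : ∀ x y : ℝ, 0 ≤ x ^ 2 * a + 2 * x * y * b + y ^ 2 * c) : 0 ≤ a * c - b ^ 2 := by
  have h1 : discrim a (2 * b) c ≤ 0 := discrim_le_zero fun x => by
    have := h x 1
    nlinarith
  rw [discrim] at h1
  nlinarith

/-- Concavity of the square root along the segment from `D` to `D + 2B`. -/
theorem convexComb_sqrt_le {D B t : ℝ} (hD : 0 ≤ D) (hB : 0 ≤ B) (h0 : 0 ≤ t) (h1 : t ≤ 1) :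
    (1 - t) * √D + t * √(D + 2 * B) ≤ √(D + 2 * t * B) := by
  have := Real.strictConcaveOn_sqrt.concaveOn.2 (x := D) (y := D + 2 * B) hD
    (by simp only [Set.mem_Ici]; positivity) (sub_nonneg.2 h1) h0 (by ring)
  simp only [smul_eq_mul] at this
  convert! this using 2
  ring

variable {S : Type*} [TopologicalSpace S] [ChartedSpace (EuclideanSpace ℝ (Fin 2)) S]
  [IsManifold (𝓡 2) ∞ S] [T2Space S] [CompactSpace S]

/-- The part of an area integral in the chart at `p`, for a density `h` in that chart. -/
def chartIntegral (p : S) (h : EuclideanSpace ℝ (Fin 2) → ℝ) : ℝ :=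
  ∫ y in (extChartAt (𝓡 2) p).target, chartPartition S p ((extChartAt (𝓡 2) p).symm y) * h y

theorem continuousOn_chartPartition (p : S) :
    ContinuousOn (fun y => chartPartition S p ((extChartAt (𝓡 2) p).symm y))
      (extChartAt (𝓡 2) p).target :=
  ((chartPartition S p).contMDiff.continuous).comp_continuousOn (continuousOn_extChartAt_symm p)

theorem integrableOn_chartPartition_mul (p : S) {h : EuclideanSpace ℝ (Fin 2) → ℝ}
    (hh : ContinuousOn h (extChartAt (𝓡 2) p).target) :
    IntegrableOn (fun y => chartPartition S p ((extChartAt (𝓡 2) p).symm y) * h y)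
      (extChartAt (𝓡 2) p).target := by
  have hsub : tsupport (chartPartition S p) ⊆ (extChartAt (𝓡 2) p).source := by
    rw [extChartAt_source]
    exact chartPartition_isSubordinate p
  set K := extChartAt (𝓡 2) p '' tsupport (chartPartition S p) with hK
  have hKc : IsCompact K := (isClosed_tsupport _).isCompact.image_of_continuousOn
    ((continuousOn_extChartAt p).mono hsub)
  have hKt : K ⊆ (extChartAt (𝓡 2) p).target := by
    rintro _ ⟨x, hx, rfl⟩
    exact (extChartAt (𝓡 2) p).map_source (hsub hx)
  have h1 : IntegrableOn (fun y => chartPartition S p ((extChartAt (𝓡 2) p).symm y) * h y) K :=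
    (((continuousOn_chartPartition p).mul hh).mono hKt).integrableOn_compact hKc
  refine h1.of_forall_sdiff_eq_zero (isOpen_extChartAt_target p).measurableSet fun y hy => ?_
  have : chartPartition S p ((extChartAt (𝓡 2) p).symm y) = 0 := by
    refine image_eq_zero_of_notMem_tsupport fun hmem => hy.2 ⟨_, hmem, ?_⟩
    exact (extChartAt (𝓡 2) p).right_inv hy.1
  rw [this, zero_mul]

theorem finite_support_chartPartition :
    {p : S | (Function.support (chartPartition S p)).Nonempty}.Finite :=
  (chartPartition S).locallyFinite.finite_nonempty_of_compact

theorem finsum_chartIntegral (h : S → EuclideanSpace ℝ (Fin 2) → ℝ) :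
    ∑ᶠ p, chartIntegral p (h p) =
      ∑ p ∈ (finite_support_chartPartition (S := S)).toFinset, chartIntegral p (h p) := by
  refine finsum_eq_sum_of_support_subset _ fun p hp => ?_
  rw [Set.Finite.coe_toFinset]
  by_contra hcon
  rw [Set.mem_ofPred_eq, Set.not_nonempty_iff_eq_empty, Function.support_eq_empty_iff] at hcon
  refine hp ?_
  have : ∀ x, chartPartition S p x = 0 := fun x => congrFun hcon x
  simp [chartIntegral, this]

/-- Areas with density `√(D + 2tB)`, with `B ≥ 0` not identically zero, increase at a positive rate
at `t = 0`, because the density is concave in `t`. -/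
theorem not_hasDerivAt_zero_of_density {D B : S → EuclideanSpace ℝ (Fin 2) → ℝ}
    (hDc : ∀ p, ContinuousOn (D p) (extChartAt (𝓡 2) p).target)
    (hBc : ∀ p, ContinuousOn (B p) (extChartAt (𝓡 2) p).target)
    (hD : ∀ p, ∀ y ∈ (extChartAt (𝓡 2) p).target, 0 ≤ D p y)
    (hB : ∀ p, ∀ y ∈ (extChartAt (𝓡 2) p).target, 0 ≤ B p y)
    {p₀ : S} {y₀ : EuclideanSpace ℝ (Fin 2)} (hy₀ : y₀ ∈ (extChartAt (𝓡 2) p₀).target)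
    (hχ₀ : 0 < chartPartition S p₀ ((extChartAt (𝓡 2) p₀).symm y₀)) (hB₀ : 0 < B p₀ y₀)
    {A : ℝ → ℝ} (hA : ∀ t, A t = ∑ᶠ p, chartIntegral p fun y => √(D p y + 2 * t * B p y)) :
    ¬ HasDerivAt A 0 0 := by
  intro hder
  set T := (finite_support_chartPartition (S := S)).toFinset with hT
  set I : S → ℝ → ℝ := fun p t => chartIntegral p fun y => √(D p y + 2 * t * B p y) with hI
  have hAI : ∀ t, A t = ∑ p ∈ T, I p t := fun t => (hA t).trans (finsum_chartIntegral _)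
  have hcont : ∀ p t, ContinuousOn (fun y => √(D p y + 2 * t * B p y))
      (extChartAt (𝓡 2) p).target := fun p t =>
    ((hDc p).add ((hBc p).const_smul (2 * t))).sqrt
  have hint := fun p t => integrableOn_chartPartition_mul p (hcont p t)
  have hmeas : ∀ p : S, MeasurableSet (extChartAt (𝓡 2) p).target := fun p =>
    (isOpen_extChartAt_target p).measurableSet
  have hχ : ∀ (p : S) x, 0 ≤ chartPartition S p x := fun p x => (chartPartition S).nonneg p x
  -- concavity in each chart
  have hconc : ∀ p t, 0 ≤ t → t ≤ 1 → (1 - t) * I p 0 + t * I p 1 ≤ I p t := by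
    intro p t h0 h1
    simp only [hI, chartIntegral]
    rw [← integral_const_mul, ← integral_const_mul,
      ← integral_add ((hint p 0).const_mul _) ((hint p 1).const_mul _)]
    refine setIntegral_mono_on (((hint p 0).const_mul _).add ((hint p 1).const_mul _)) (hint p t)
      (hmeas p) fun y hy => ?_
    have := mul_le_mul_of_nonneg_left (convexComb_sqrt_le (hD p y hy) (hB p y hy) h0 h1)
      (hχ p ((extChartAt (𝓡 2) p).symm y))
    simp only [mul_zero, zero_mul, add_zero, mul_one]
    linarith
  have hmono : ∀ p, ∀ y ∈ (extChartAt (𝓡 2) p).target,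
      √(D p y + 2 * 0 * B p y) ≤ √(D p y + 2 * 1 * B p y) := fun p y hy =>
    Real.sqrt_le_sqrt (by have := hB p y hy; linarith)
  have hle : ∀ p, I p 0 ≤ I p 1 := fun p =>
    setIntegral_mono_on (hint p 0) (hint p 1) (hmeas p) fun y hy =>
      mul_le_mul_of_nonneg_left (hmono p y hy) (hχ p _)
  -- strict increase in the chart at `p₀`
  have hlt : I p₀ 0 < I p₀ 1 := by
    rw [← sub_pos]
    simp only [hI, chartIntegral]
    rw [← integral_sub (hint p₀ 1) (hint p₀ 0)]
    set f : EuclideanSpace ℝ (Fin 2) → ℝ := fun y =>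
      chartPartition S p₀ ((extChartAt (𝓡 2) p₀).symm y) * √(D p₀ y + 2 * 1 * B p₀ y) -
      chartPartition S p₀ ((extChartAt (𝓡 2) p₀).symm y) * √(D p₀ y + 2 * 0 * B p₀ y) with hf
    have hfc : ContinuousOn f (extChartAt (𝓡 2) p₀).target :=
      ((continuousOn_chartPartition p₀).mul (hcont p₀ 1)).sub
        ((continuousOn_chartPartition p₀).mul (hcont p₀ 0))
    have hf0 : 0 < f y₀ := by
      have := Real.sqrt_lt_sqrt (x := D p₀ y₀ + 2 * 0 * B p₀ y₀) (y := D p₀ y₀ + 2 * 1 * B p₀ y₀)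
        (by simpa using hD p₀ y₀ hy₀) (by linarith)
      exact sub_pos.2 (mul_lt_mul_of_pos_left this hχ₀)
    refine (setIntegral_pos_iff_support_of_nonneg_ae ?_ ((hint p₀ 1).sub (hint p₀ 0))).2 ?_
    · refine (ae_restrict_iff' (hmeas p₀)).2 (Filter.Eventually.of_forall fun y hy => ?_)
      exact sub_nonneg.2 (mul_le_mul_of_nonneg_left (hmono p₀ y hy) (hχ p₀ _))
    · rw [Set.inter_comm]
      exact (hfc.isOpen_inter_preimage (isOpen_extChartAt_target p₀)
        isOpen_compl_singleton).measure_pos _ ⟨y₀, hy₀, hf0.ne'⟩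
  have hp₀ : p₀ ∈ T := by
    rw [hT, Set.Finite.mem_toFinset]
    exact ⟨_, hχ₀.ne'⟩
  have hK : 0 < A 1 - A 0 := by
    rw [hAI, hAI, sub_pos]
    exact Finset.sum_lt_sum (fun p _ => hle p) ⟨p₀, hp₀, hlt⟩
  have hslope : ∀ᶠ t in 𝓝[>] (0 : ℝ), A 1 - A 0 ≤ t⁻¹ • (A (0 + t) - A 0) := by
    filter_upwards [Ioc_mem_nhdsGT (zero_lt_one' ℝ)] with t ht
    have h1 : (1 - t) * A 0 + t * A 1 ≤ A t := by
      rw [hAI, hAI, hAI, Finset.mul_sum, Finset.mul_sum, ← Finset.sum_add_distrib]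
      exact Finset.sum_le_sum fun p _ => hconc p t ht.1.le ht.2
    rw [zero_add, smul_eq_mul, inv_mul_eq_div, le_div_iff₀ ht.1]
    linarith
  exact absurd (ge_of_tendsto hder.tendsto_slope_zero_right hslope) (not_le.2 hK)

end Area

/-! ### First variation of the area -/

section FirstVariation

variable {E : Type*} [NormedAddCommGroup E] [NormedSpace ℝ E]
  {M : Type*} [TopologicalSpace M] [ChartedSpace E M]


theorem apply_lincomb_left {V : Type*} [AddCommGroup V] [Module ℝ V] [TopologicalSpace V]
    (η : V [⋀^Fin 2]→L[ℝ] ℝ) (a b : ℝ) (v w u : V) :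
    η ![a • v + b • w, u] = a * η ![v, u] + b * η ![w, u] := by
  have h1 := η.vecCons_add ![u] (a • v) (b • w)
  have h2 := η.vecCons_smul ![u] a v
  have h3 := η.vecCons_smul ![u] b w
  rw [h2, h3] at h1
  exact h1

theorem apply_swap {V : Type*} [AddCommGroup V] [Module ℝ V] [TopologicalSpace V]
    (η : V [⋀^Fin 2]→L[ℝ] ℝ) (v w : V) : η ![v, w] = -η ![w, v] := by
  have h := η.toAlternatingMap.map_swap ![w, v] (show (0 : Fin 2) ≠ 1 by decide)
  have e : (![w, v] ∘ Equiv.swap (0 : Fin 2) 1) = ![v, w] := by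
    funext i; fin_cases i <;> simp
  rw [e] at h
  exact h

theorem apply_lincomb_right {V : Type*} [AddCommGroup V] [Module ℝ V] [TopologicalSpace V]
    (η : V [⋀^Fin 2]→L[ℝ] ℝ) (a b : ℝ) (v w u : V) :
    η ![u, a • v + b • w] = a * η ![u, v] + b * η ![u, w] := by
  rw [apply_swap, apply_lincomb_left, apply_swap η u v, apply_swap η u w]
  ring

/-- The quadratic form of the metric `g_ρ` expands as for a symmetric bilinear form. -/
theorem metricRho_quadratic (Ω : Form E M 2) (J : EndField E M) (ρ : M → ℝ) (x : M) (a b : ℝ)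
    (v w : TangentSpace 𝓘(ℝ, E) x) :
    metricRho Ω J ρ x (a • v + b • w) (a • v + b • w) =
      a ^ 2 * metricRho Ω J ρ x v v + 2 * a * b * metricRho Ω J ρ x v w +
        b ^ 2 * metricRho Ω J ρ x w w := by
  have hJ : J x (a • v + b • w) = a • J x v + b • J x w := by rw [map_add, map_smul, map_smul]
  simp only [metricRho, hJ, apply_lincomb_left, apply_lincomb_right]
  ring

theorem metricRho_symm (Ω : Form E M 2) (J : EndField E M) (ρ : M → ℝ) (x : M)
    (v w : TangentSpace 𝓘(ℝ, E) x) : metricRho Ω J ρ x v w = metricRho Ω J ρ x w v := by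
  rw [metricRho, metricRho, add_comm]

theorem metricRho_pos {Ω : Form E M 2} {J : EndField E M} {ρ : M → ℝ}
    (hρ : Tames (omegaRho Ω J ρ) J) {x : M} {v : TangentSpace 𝓘(ℝ, E) x} (hv : v ≠ 0) :
    0 < metricRho Ω J ρ x v v := by
  rw [metricRho, add_self_div_two]
  exact hρ x v hv

theorem metricRho_nonneg {Ω : Form E M 2} {J : EndField E M} {ρ : M → ℝ}
    (hρ : Tames (omegaRho Ω J ρ) J) (x : M) (v : TangentSpace 𝓘(ℝ, E) x) :
    0 ≤ metricRho Ω J ρ x v v := by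
  by_cases hv : v = 0
  · have := metricRho_quadratic Ω J ρ x 0 0 v v
    simp only [zero_smul, add_zero] at this
    rw [hv, this]
    simp
  · exact (metricRho_pos hρ hv).le

variable [IsManifold 𝓘(ℝ, E) ∞ M]

/-- Along vectors tangent to the zero set of `b`, the metric of `ρ + t b²` is that of `ρ` plus
`2t` times the square of `d^c b`. -/
theorem metricRho_add_sq (Ω : Form E M 2) {J : EndField E M} (hJ : IsAlmostComplex J)
    {ρ b : M → ℝ} (hρ : ContMDiff 𝓘(ℝ, E) 𝓘(ℝ, ℝ) ∞ ρ) (hb : ContMDiff 𝓘(ℝ, E) 𝓘(ℝ, ℝ) ∞ b)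
    (t : ℝ) {x : M} (hx : b x = 0) {v w : TangentSpace 𝓘(ℝ, E) x}
    (hv : dfun (E := E) b x v = 0) (hw : dfun (E := E) b x w = 0) :
    metricRho Ω J (fun x => ρ x + t * b x ^ 2) x v w =
      metricRho Ω J ρ x v w + 2 * t * (dc J b).sqTensor x v w := by
  have hd : ∀ u u' : TangentSpace 𝓘(ℝ, E) x, dfun (E := E) b x u = 0 →
      (dc J (fun x => b x ^ 2)).d x ![u, J x u'] = 2 * (dc J b x ![u] * dc J b x ![u']) := by
    intro u u' hu
    have h1 : dfun (E := E) b x (J x u') = -dc J b x ![u'] := (neg_neg _).symm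
    rw [d_dc_sq hJ hb hx, hu, h1]
    ring
  have ho : ∀ u u' : TangentSpace 𝓘(ℝ, E) x, dfun (E := E) b x u = 0 →
      omegaRho Ω J (fun x => ρ x + t * b x ^ 2) x ![u, J x u'] =
        omegaRho Ω J ρ x ![u, J x u'] + t * (2 * (dc J b x ![u] * dc J b x ![u'])) := by
    intro u u' hu
    rw [omegaRho_add_smul Ω hJ hρ (hb.pow 2), ← hd u u' hu]
    rfl
  rw [metricRho, metricRho, ho v w hv, ho w v hw, Form.sqTensor]
  ring

omit [IsManifold 𝓘(ℝ, E) ∞ M] in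
theorem contMDiffOn_path {ρ φ : M → ℝ} (hρ : ContMDiff 𝓘(ℝ, E) 𝓘(ℝ, ℝ) ∞ ρ)
    (hφ : ContMDiff 𝓘(ℝ, E) 𝓘(ℝ, ℝ) ∞ φ) (s : Set (ℝ × M)) :
    ContMDiffOn (𝓘(ℝ, ℝ).prod 𝓘(ℝ, E)) 𝓘(ℝ, ℝ) ∞ (fun z : ℝ × M => ρ z.2 + z.1 * φ z.2) s :=
  ((hρ.comp contMDiff_snd).add (contMDiff_fst.mul (hφ.comp contMDiff_snd))).contMDiffOn

variable {S : Type*} [TopologicalSpace S] [ChartedSpace (EuclideanSpace ℝ (Fin 2)) S]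
  [IsManifold (𝓡 2) ∞ S] [T2Space S] [CompactSpace S]

/-- A function `b` that vanishes along `F`, but with `d^c b` not vanishing on all tangent planes
of `F`, rules out critical points: the area increases at a positive rate along `ρ + t b²`. -/
theorem not_isCriticalPoint [FiniteDimensional ℝ E] [CompactSpace M] {Ω : Form E M 2}
    (hΩ : Ω.IsSmooth) {J : EndField E M} (hJ : IsAlmostComplex J) {F : S → M}
    (hF : Manifold.IsImmersion (𝓡 2) 𝓘(ℝ, E) ∞ F) {b : M → ℝ}
    (hb : ContMDiff 𝓘(ℝ, E) 𝓘(ℝ, ℝ) ∞ b) (hbF : ∀ z, b (F z) = 0) {p : S}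
    {e : TangentSpace (𝓡 2) p} (he : dc J b (F p) ![mfderiv (𝓡 2) 𝓘(ℝ, E) F p e] ≠ 0)
    (ρ : M → ℝ) : ¬ IsCriticalPoint Ω J F ρ := by
  intro hcrit
  obtain ⟨hρ, hρt⟩ := hcrit.mem
  have hFs : ContMDiff (𝓡 2) 𝓘(ℝ, E) ∞ F := hF.contMDiff
  have hb2 : ContMDiff 𝓘(ℝ, E) 𝓘(ℝ, ℝ) ∞ (fun x => b x ^ 2) := hb.pow 2
  obtain ⟨ε, hε, hpot⟩ := exists_potential_path hΩ hJ hcrit.mem hb2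
  have hder := hcrit.deriv_zero ε (fun t x => ρ x + t * b x ^ 2) hε (contMDiffOn_path hρ hb2 _)
    hpot (by simp)
  -- `db` vanishes on the tangent planes of `F`
  have hdb : ∀ z (v : TangentSpace (𝓡 2) z),
      dfun (E := E) b (F z) (mfderiv (𝓡 2) 𝓘(ℝ, E) F z v) = 0 := by
    intro z v
    have h1 := mfderiv_comp (I' := 𝓘(ℝ, E)) z ((hb (F z)).mdifferentiableAt (by simp))
      ((hFs z).mdifferentiableAt (by simp))
    have h2 : b ∘ F = fun _ => (0 : ℝ) := funext hbF
    rw [h2, mfderiv_const] at h1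
    exact (congrArg (fun L => L v) h1).symm
  let ei : Fin 2 → EuclideanSpace ℝ (Fin 2) := fun i => EuclideanSpace.single i 1
  let g : S → EuclideanSpace ℝ (Fin 2) → Fin 2 → Fin 2 → ℝ := fun p y i j =>
    pullback F (metricRho Ω J ρ) ((extChartAt (𝓡 2) p).symm y)
      (chartInvDeriv p y (ei i)) (chartInvDeriv p y (ei j))
  let q : S → EuclideanSpace ℝ (Fin 2) → Fin 2 → Fin 2 → ℝ := fun p y i j =>
    pullback F (dc J b).sqTensor ((extChartAt (𝓡 2) p).symm y)
      (chartInvDeriv p y (ei i)) (chartInvDeriv p y (ei j))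
  let β : S → EuclideanSpace ℝ (Fin 2) → Fin 2 → ℝ := fun p y i =>
    dc J b (F ((extChartAt (𝓡 2) p).symm y)) ![mfderiv (𝓡 2) 𝓘(ℝ, E) F
      ((extChartAt (𝓡 2) p).symm y) (chartInvDeriv p y (ei i))]
  have hq : ∀ p y i j, q p y i j = β p y i * β p y j := fun _ _ _ _ => rfl
  have hgs : ∀ p y, g p y 1 0 = g p y 0 1 := fun p y => metricRho_symm _ _ _ _ _ _
  have hgc : ∀ p i j, ContinuousOn (fun y => g p y i j) (extChartAt (𝓡 2) p).target :=
    fun p i j => continuousOn_pullback hFs (isContinuous_metricRho hΩ hJ hρ) p _ _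
  have hqc : ∀ p i j, ContinuousOn (fun y => q p y i j) (extChartAt (𝓡 2) p).target :=
    fun p i j => continuousOn_pullback hFs (isSmooth_dc hJ hb).isContinuous_sqTensor p _ _
  have hquad : ∀ p y (x₁ x₂ : ℝ), x₁ ^ 2 * g p y 0 0 + 2 * x₁ * x₂ * g p y 0 1 +
      x₂ ^ 2 * g p y 1 1 = pullback F (metricRho Ω J ρ) ((extChartAt (𝓡 2) p).symm y)
        (chartInvDeriv p y (x₁ • ei 0 + x₂ • ei 1)) (chartInvDeriv p y (x₁ • ei 0 + x₂ • ei 1)) := by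
    intro p y x₁ x₂
    simp only [pullback, map_add, map_smul]
    exact (metricRho_quadratic _ _ _ _ _ _ _ _).symm
  have hgnn : ∀ p y (x₁ x₂ : ℝ), 0 ≤ x₁ ^ 2 * g p y 0 0 + 2 * x₁ * x₂ * g p y 0 1 +
      x₂ ^ 2 * g p y 1 1 := fun p y x₁ x₂ => by
    rw [hquad]
    exact metricRho_nonneg hρt _ _
  -- the `t`-derivative of the Gram determinant is twice the square of the `g_ρ`-length of a vector
  have hBeq : ∀ p y, q p y 0 0 * g p y 1 1 - 2 * q p y 0 1 * g p y 0 1 + q p y 1 1 * g p y 0 0 =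
      (β p y 1) ^ 2 * g p y 0 0 + 2 * β p y 1 * (-β p y 0) * g p y 0 1 +
        (-β p y 0) ^ 2 * g p y 1 1 := by
    intro p y
    rw [hq, hq, hq]
    ring
  obtain ⟨p₀, hp₀⟩ := (chartPartition S).exists_pos_of_mem (Set.mem_univ p)
  have hps : p ∈ (extChartAt (𝓡 2) p₀).source := by
    rw [extChartAt_source]
    exact chartPartition_isSubordinate p₀ (subset_tsupport _ hp₀.ne')
  have hyt : extChartAt (𝓡 2) p₀ p ∈ (extChartAt (𝓡 2) p₀).target :=
    (extChartAt (𝓡 2) p₀).map_source hps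
  have hsymm : (extChartAt (𝓡 2) p₀).symm (extChartAt (𝓡 2) p₀ p) = p :=
    (extChartAt (𝓡 2) p₀).left_inv hps
  refine not_hasDerivAt_zero_of_density
    (D := fun p y => g p y 0 0 * g p y 1 1 - g p y 0 1 ^ 2)
    (B := fun p y => q p y 0 0 * g p y 1 1 - 2 * q p y 0 1 * g p y 0 1 + q p y 1 1 * g p y 0 0)
    (p₀ := p₀) (y₀ := extChartAt (𝓡 2) p₀ p)
    (fun p => ((hgc p 0 0).mul (hgc p 1 1)).sub ((hgc p 0 1).pow 2))
    (fun p => (((hqc p 0 0).mul (hgc p 1 1)).sub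
      ((continuousOn_const.mul (hqc p 0 1)).mul (hgc p 0 1))).add ((hqc p 1 1).mul (hgc p 0 0)))
    (fun p y _ => det_nonneg_of_quadratic_nonneg (hgnn p y))
    (fun p y _ => (hBeq p y).symm ▸ hgnn p y _ _)
    hyt (by rw [hsymm]; exact hp₀) ?_ ?_ hder
  · -- strict positivity at `p`, where the restriction of `d^c b` does not vanish
    rw [hBeq, hquad]
    set y := extChartAt (𝓡 2) p₀ p with hy
    have hβ : ∃ e, dc J b (F ((extChartAt (𝓡 2) p₀).symm y))
        ![mfderiv (𝓡 2) 𝓘(ℝ, E) F ((extChartAt (𝓡 2) p₀).symm y) e] ≠ 0 := by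
      rw [hsymm]
      exact ⟨e, he⟩
    obtain ⟨e, he⟩ := hβ
    refine metricRho_pos hρt fun h0 => he ?_
    have h1 := IsImmersion.injective_mfderiv hF _ (h0.trans (map_zero _).symm)
    have h2 := congrArg (chartDerivAt (EuclideanSpace ℝ (Fin 2)) p₀ _) h1
    rw [chartDerivAt_chartInvDeriv p₀ hyt, map_zero] at h2
    have hβ1 : β p₀ y 1 = 0 := by
      simpa [ei] using congrArg (fun v : EuclideanSpace ℝ (Fin 2) => v 0) h2
    have hβ0 : β p₀ y 0 = 0 := by
      simpa [ei] using congrArg (fun v : EuclideanSpace ℝ (Fin 2) => v 1) h2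
    set e' := chartDerivAt (EuclideanSpace ℝ (Fin 2)) p₀ _ e with he'
    have h3 : e = chartInvDeriv p₀ y (e' 0 • ei 0 + e' 1 • ei 1) := by
      rw [← chartInvDeriv_chartDerivAt p₀ hyt e]
      congr 1
      ext i
      fin_cases i <;> simp [ei, he']
    have hlin : ∀ (x : M) (v w : TangentSpace 𝓘(ℝ, E) x) (a c : ℝ),
        dc J b x ![a • v + c • w] = a * dc J b x ![v] + c * dc J b x ![w] := by
      intro x v w a c
      change -(dfun (E := E) b x (J x (a • v + c • w))) =
        a * -(dfun (E := E) b x (J x v)) + c * -(dfun (E := E) b x (J x w))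
      rw [map_add, map_smul, map_smul, map_add, map_smul, map_smul, smul_eq_mul, smul_eq_mul]
      ring
    rw [h3, map_add, map_smul, map_smul, map_add, map_smul, map_smul, hlin]
    change e' 0 * β p₀ y 0 + e' 1 * β p₀ y 1 = 0
    rw [hβ0, hβ1]
    ring
  · -- the Gram determinant is affine in `t`, since `q` has rank one
    intro t
    refine finsum_congr fun p => ?_
    refine MeasureTheory.setIntegral_congr_fun (isOpen_extChartAt_target p).measurableSet
      fun y hy => ?_
    have hgram : ∀ i j, gramInChart (pullback F (metricRho Ω J fun x => ρ x + t * b x ^ 2)) p y i j =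
        g p y i j + 2 * t * q p y i j := fun i j =>
      metricRho_add_sq Ω hJ hρ hb t (hbF _) (hdb _ _) (hdb _ _)
    simp only [Matrix.det_fin_two, hgram]
    congr 2
    rw [hgs, hq, hq, hq, hq]
    ring

end FirstVariation

end JCurve

end

theorem theorem2p5 (n : ℕ)
    {M : Type*} [TopologicalSpace M] [ChartedSpace (EuclideanSpace ℝ (Fin (2 * n))) M]
    [IsManifold (𝓡 (2 * n)) ∞ M] [T2Space M] [CompactSpace M]
    {S : Type*} [TopologicalSpace S] [ChartedSpace (EuclideanSpace ℝ (Fin 2)) S]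
    [IsManifold (𝓡 2) ∞ S] [T2Space S] [CompactSpace S]
    (Ω : JCurve.Form (EuclideanSpace ℝ (Fin (2 * n))) M 2) (hΩ : JCurve.IsSymplectic Ω)
    (J : JCurve.EndField (EuclideanSpace ℝ (Fin (2 * n))) M) (hJ : JCurve.IsAlmostComplex J)
    (hΩJ : JCurve.IsCompatible Ω J)
    (F : S → M) (hF : Manifold.IsImmersion (𝓡 2) (𝓡 (2 * n)) ∞ F)
    (hcrit : ∃ ρ : M → ℝ, JCurve.IsCriticalPoint Ω J F ρ) :
    JCurve.IsJHolomorphic J F := by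
  by_contra hne
  obtain ⟨b, hb, hbF, p, e, he⟩ := JCurve.exists_test_function hJ hF hne
  obtain ⟨ρ, hρ⟩ := hcrit
  exact JCurve.not_isCriticalPoint hΩ.smooth hJ hF hb hbF he ρ hρ
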